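/- Consider a pointer machine: its memory is an expandable directed graph of data nodes (each storing one element of a linearly ordered universe, which can be compared but not manipulated) and pointer nodes (each storing a constant number of bits), every node has a constant number of pointers, and one pointer node is the root. A program has a working memory of constantly many cells, each pointing to a node; at the start it holds the root and the arguments. The instructions are: compare two nodes of the same type, apply an operator to the bits of pointer nodes, copy a pointer between cells, follow a pointer, create a pointer node, store a pointer in a node, branch on a bit, and halt. The running time is the number of instructions executed until the program halts. For $n\in\mathbb N$ let $\alpha(n)=\min\{k\ge 1: n\le A(k,k)\}$, where $A$ is the Ackermann function ($A(0,n)=n+1$, $A(m+1,0)=A(m,1)$, $A(m+1,n+1)=A(m,A(m+1,n))$). A union-find data structure maintains, for a partition of the data nodes into sets, a representative node from each set, under the following operations. $\mathrm{MakeSet}$ adds a new data node and makes it a singleton set, represented by that node, which is returned. $\mathrm{Link}(r,r')$, for representatives $r,r'$ of two different sets, replaces these sets by their union and returns the representative of the union, a node of it chosen by the data structure. $\mathrm{Find}(x_j)$, for a data node $x_j$, returns the representative of the set that currently contains $x_j$. **Lemma.** There is a union-find data structure on a pointer machine that supports $\mathrm{MakeSet}$ and $\mathrm{Link}$ in amortized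 $O(1)$ time and $\mathrm{Find}(x_j)$ in amortized $O(\alpha(|S|))$ time, where $S$ is the set that contains $x_j$ at the time of the operation. That is, there are fixed programs for the three operations and a constant $C$ such that, for every finite sequence of legal operations, starting from a memory that consists of the root only, every call halts with correct output, after every operation all data nodes are reachable from the root, and the total running time of the sequence is at most $$C\cdot\Big(\#\mathrm{MakeSet}+\#\mathrm{Link}+\sum_{\mathrm{Find}(x)}\alpha(|S_x|)\Big),$$ where $S_x$ is the set that contains $x$ when that $\mathrm{Find}(x)$ is executed. -/

import Mathlib

/-! ## Pointer machines -/

namespace PointerMachine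

/-- Names of nodes. Programs never see these numbers: the only thing they can do with the name
of a node is to hold it, follow it, store it, and test it for equality with another one. -/
abbrev Node := ℕ

/-- The distinguished root of a data structure, a pointer node. -/
def root : Node := 0

/-- The constantly many bits that a pointer node stores. -/
abbrev Word (b : ℕ) := Fin b → Bool

/-- The contents of the machine: nodes `0, …, size - 1`. A data node stores an element of `D`,
a pointer node stores `b` bits, and every node has `d` pointer fields. A pointer field that
has not been assigned yet points to its own node. -/
structure Memory (D : Type*) (d b : ℕ) where
  /-- number of nodes, which is also the name of the next new node -/
  size : ℕ
  /-- the datum of a data node, or the bits of a pointer node -/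
  content : Node → D ⊕ Word b
  /-- the pointers -/
  ptr : Node → Fin d → Node

namespace Memory

variable {D : Type*} {d b : ℕ}

/-- The initial memory: the root only. -/
def init : Memory D d b where
  size := 1
  content _ := Sum.inr fun _ => false
  ptr x _ := x

/-- Add a new node, named `m.size`, with the given content and with no pointer assigned. -/
def alloc (m : Memory D d b) (c : D ⊕ Word b) : Memory D d b where
  size := m.size + 1
  content := Function.update m.content m.size c
  ptr := Function.update m.ptr m.size fun _ => m.size

/-- Let the `p`-th pointer of the node `x` point to the node `y`. -/
def setPtr (m : Memory D d b) (x : Node) (p : Fin d) (y : Node) : Memory D d b :=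
  { m with ptr := Function.update m.ptr x (Function.update (m.ptr x) p y) }

/-- There is a directed path of pointers from `x` to `y`. -/
def Reachable (m : Memory D d b) (x y : Node) : Prop :=
  Relation.ReflTransGen (fun u v => ∃ p, m.ptr u p = v) x y

end Memory

/-- The instructions of a machine with `d` pointers per node, `b` bits per pointer node, and a
working memory of `w + 3` cells (so that there is room for the root and two arguments). -/
inductive Instr (d b w : ℕ) where
  /-- Compare the nodes in cells `i` and `j`, which have to be of the same type, for identity;
  cell `r` receives a new pointer node that stores the outcome. -/
  | sameNode (r i j : Fin (w + 3))
  /-- Compare the data of the data nodes in cells `i` and `j`; cell `r` receives a new pointer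
  node that stores whether the first is at most the second. -/
  | leData (r i j : Fin (w + 3))
  /-- Apply an operator to the bits of the pointer nodes in cells `i` and `j`; the pointer node
  in cell `r` is replaced by a new pointer node that stores the result. -/
  | atomic (f : Word b → Word b → Word b) (r i j : Fin (w + 3))
  /-- Let cell `r` point to the node in cell `i`. -/
  | copy (r i : Fin (w + 3))
  /-- Replace the node in cell `r` by the node that its `p`-th pointer points to. -/
  | traverse (r : Fin (w + 3)) (p : Fin d)
  /-- Create a new pointer node, with all bits `false`, in cell `r`. -/
  | create (r : Fin (w + 3))
  /-- Let the `p`-th pointer of the node in cell `i` point to the node in cell `j`. -/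
  | store (i : Fin (w + 3)) (p : Fin d) (j : Fin (w + 3))
  /-- Continue with instruction number `yes` if the `q`-th bit of the pointer node in cell `i` is
  `true`, and with instruction number `no` otherwise. -/
  | branch (i : Fin (w + 3)) (q : Fin b) (yes no : ℕ)
  /-- End of the computation. -/
  | halt

/-- A program is a finite list of instructions. -/
abbrev Program (d b w : ℕ) := List (Instr d b w)

/-- A configuration during the run of a program: the number of the next instruction, the memory,
and the working memory, each cell of which points to a node. -/
structure Config (D : Type*) (d b w : ℕ) where
  pc : ℕ
  mem : Memory D d b
  cell : Fin (w + 3) → Node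

section Semantics

variable {D : Type*} [LinearOrder D] {d b w : ℕ}

/-- Put a new pointer node with bits `v` into cell `r` and go on to the next instruction. -/
def Config.emit (c : Config D d b w) (r : Fin (w + 3)) (v : Word b) : Config D d b w where
  pc := c.pc + 1
  mem := c.mem.alloc (Sum.inr v)
  cell := Function.update c.cell r c.mem.size

/-- The effect of one instruction. There is none (`none`) for `halt`, and for an instruction that
is applied to nodes of the wrong type. -/
def Instr.exec (c : Config D d b w) : Instr d b w → Option (Config D d b w)
  | .sameNode r i j =>
    if (c.mem.content (c.cell i)).isLeft = (c.mem.content (c.cell j)).isLeft then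
      some (c.emit r fun _ => decide (c.cell i = c.cell j))
    else none
  | .leData r i j =>
    match c.mem.content (c.cell i), c.mem.content (c.cell j) with
    | Sum.inl x, Sum.inl y => some (c.emit r fun _ => decide (x ≤ y))
    | _, _ => none
  | .atomic f r i j =>
    match c.mem.content (c.cell r), c.mem.content (c.cell i), c.mem.content (c.cell j) with
    | Sum.inr _, Sum.inr u, Sum.inr v => some (c.emit r (f u v))
    | _, _, _ => none
  | .copy r i => some { c with pc := c.pc + 1, cell := Function.update c.cell r (c.cell i) }
  | .traverse r p =>
    some { c with
      pc := c.pc + 1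
      cell := Function.update c.cell r (c.mem.ptr (c.cell r) p) }
  | .create r => some (c.emit r fun _ => false)
  | .store i p j => some { c with pc := c.pc + 1, mem := c.mem.setPtr (c.cell i) p (c.cell j) }
  | .branch i q yes no =>
    match c.mem.content (c.cell i) with
    | Sum.inr v => some { c with pc := if v q then yes else no }
    | Sum.inl _ => none
  | .halt => none

/-- `Runs P c t c'`: started in configuration `c`, the program `P` reaches a `halt` instruction in
configuration `c'`, and `t` is the total number of instructions executed, `halt` included.
Both `t` and `c'` are determined by `P` and `c`. -/
inductive Runs (P : Program d b w) : Config D d b w → ℕ → Config D d b w → Prop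
  | halt {c : Config D d b w} (h : P[c.pc]? = some Instr.halt) : Runs P c 1 c
  | step {c c₁ c' : Config D d b w} {I : Instr d b w} {t : ℕ} (h : P[c.pc]? = some I)
      (hc : I.exec c = some c₁) (hr : Runs P c₁ t c') : Runs P c (t + 1) c'

/-- The program `P` is called on the memory `m` with the pointers `args` as arguments: at the start
cell `0` holds the root, the following cells hold the arguments, and all others the root.
It halts after `t` instructions, leaves the memory `m'`, and returns the node in cell `0`. -/
def Call (P : Program d b w) (m : Memory D d b) (args : List Node)
    (t : ℕ) (m' : Memory D d b) (out : Node) : Prop :=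
  ∃ c' : Config D d b w,
    Runs P ⟨0, m, fun i => (root :: args).getD i root⟩ t c' ∧ c'.mem = m' ∧ c'.cell 0 = out

end Semantics

end PointerMachine

/-! ## The union-find problem -/

namespace UnionFind

open PointerMachine

/-- A family of disjoint sets of data nodes, each with a representative: the nodes in the sets,
and the representative of the set that contains a given node (irrelevant for other nodes). -/
structure SetSystem where
  elems : Finset Node
  rep : Node → Node

namespace SetSystem

/-- No sets. -/
def empty : SetSystem := ⟨∅, id⟩

/-- The set that contains the node `x`. -/
def setOf (S : SetSystem) (x : Node) : Finset Node := {y ∈ S.elems | S.rep y = S.rep x}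

/-- `r` is the representative of one of the sets. -/
def IsRep (S : SetSystem) (r : Node) : Prop := r ∈ S.elems ∧ S.rep r = r

/-- Add the new set `{x}`. -/
def addSingleton (S : SetSystem) (x : Node) : SetSystem where
  elems := insert x S.elems
  rep := Function.update S.rep x x

/-- Replace the sets that contain `r` and `r'` by their union, with representative `s`. -/
def merge (S : SetSystem) (r r' s : Node) : SetSystem where
  elems := S.elems
  rep y := if S.rep y = S.rep r ∨ S.rep y = S.rep r' then s else S.rep y

end SetSystem

/-- The operations. -/
inductive Op (D : Type*) where
  /-- Add a new data node with datum `v` to the input and make it a singleton set. -/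
  | makeSet (v : D)
  /-- Unite the sets with representatives `r` and `r'`. -/
  | link (r r' : Node)
  /-- Return the representative of the set that contains `x`. -/
  | find (x : Node)

/-- A union-find implementation on a pointer machine: the constants of the machine and one program
per operation. -/
structure Implementation where
  /-- number of pointers per node -/
  d : ℕ
  /-- number of bits per pointer node -/
  b : ℕ
  /-- size of the working memory, minus three -/
  w : ℕ
  makeSet : Program d b w
  link : Program d b w
  find : Program d b w

variable {D : Type*}

/-- When an operation may be invoked: `link` needs the representatives of two different sets, and
`find` needs a node that is in a set. -/
def Op.Legal (S : SetSystem) : Op D → Prop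
  | .makeSet _ => True
  | .link r r' => S.IsRep r ∧ S.IsRep r' ∧ r ≠ r'
  | .find x => x ∈ S.elems

/-- What an operation has to return, and how it changes the sets. The argument `x` is the name of
the new data node in the case of `makeSet`. The implementation is free to choose
which node of a union becomes its representative; `link` returns it. -/
def Op.Spec (S : SetSystem) (x out : Node) (S' : SetSystem) : Op D → Prop
  | .makeSet _ => out = x ∧ S' = S.addSingleton x
  | .link r r' => out ∈ S.setOf r ∪ S.setOf r' ∧ S' = S.merge r r' out
  | .find y => out = S.rep y ∧ S' = S

/-- The program of an operation is called and halts after `t` instructions. For `makeSet` the new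
data node is first added to the memory, and the program receives a pointer to it. -/
def Implementation.CallOp [LinearOrder D] (U : Implementation) (m : Memory D U.d U.b) (t : ℕ)
    (m' : Memory D U.d U.b) (out : Node) : Op D → Prop
  | .makeSet v => Call U.makeSet (m.alloc (Sum.inl v)) [m.size] t m' out
  | .link r r' => Call U.link m [r, r'] t m' out
  | .find x => Call U.find m [x] t m' out

/-- From memory `m` and sets `S`, the operation `op` halts after `t` instructions, with correct
output, and leads to memory `m'` and sets `S'`. -/
def Implementation.Performs [LinearOrder D] (U : Implementation)
    (m : Memory D U.d U.b) (S : SetSystem) (op : Op D) (t : ℕ)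
    (m' : Memory D U.d U.b) (S' : SetSystem) : Prop :=
  ∃ out, U.CallOp m t m' out op ∧ op.Spec S m.size out S'

/-- The inverse Ackermann function: the least `k ≥ 1` with `n ≤ A(k, k)`. -/
noncomputable def invAck (n : ℕ) : ℕ := sInf {k | 1 ≤ k ∧ n ≤ ack k k}

/-- The amortized cost of an operation, up to a constant factor: `1` for `makeSet` and `link`, and
the inverse Ackermann function of the size of the current set of `x` for `find x`. -/
noncomputable def Op.cost (S : SetSystem) : Op D → ℕ
  | .makeSet _ => 1
  | .link _ _ => 1
  | .find x => invAck (S.setOf x).card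

/-- `U.History ops m S t a`: starting with the root only and no sets, the sequence `ops` of legal
operations has been performed correctly; this led to memory `m` and sets `S`, took `t`
instructions in total, and `a` is the sum of the amortized costs of the operations, each
taken at the time of the operation. -/
inductive Implementation.History [LinearOrder D] (U : Implementation) :
    List (Op D) → Memory D U.d U.b → SetSystem → ℕ → ℕ → Prop
  | nil : U.History [] Memory.init SetSystem.empty 0 0
  | snoc {ops : List (Op D)} {m m' : Memory D U.d U.b} {S S' : SetSystem} {t t' a : ℕ} {op : Op D}
      (h : U.History ops m S t a) (legal : op.Legal S) (perf : U.Performs m S op t' m' S') :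
      U.History (ops ++ [op]) m' S' (t + t') (a + op.cost S)

/-- `U` solves the union-find problem for data from `D`: after every sequence of legal operations,
every further legal operation halts with correct output, and all data nodes can be reached
from the root. -/
def Implementation.Correct (D : Type*) [LinearOrder D] (U : Implementation) : Prop :=
  ∀ (ops : List (Op D)) (m : Memory D U.d U.b) (S : SetSystem) (t a : ℕ), U.History ops m S t a →
    (∀ op : Op D, op.Legal S → ∃ t' m' S', U.Performs m S op t' m' S') ∧
    ∀ x ∈ S.elems, m.Reachable root x

end UnionFind

namespace UnionFind

open PointerMachine

/-! ### The inverse Ackermann function and the potential of a node -/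

/-! The data structure is linking by rank with path compression; since the machine has no numbers,
ranks are stored in unary, as chains of pointer nodes. The potential involves ranks only, never the
total number of elements, and therefore charges a `find` by the size of the set at hand.

For a non-root `u`, let ρ be its rank plus one and σ the rank of its parent plus one. Its potential
counts the pairs (k, j) with k < ρ and j ≤ ρ + 1 such that σ is still below the j-th iterate of `ack
k` at ρ. As ρ is fixed and σ never decreases, this number never increases. The level of `u` is the
greatest k with A(k, ρ) ≤ σ. If k < ρ and a later node of the compressed path has the same level,
compression raises σ to at least A(k, σ), so one more threshold is reached and the potential of `u`
drops (`card_thresholds_lt`). Among the nodes of level below ρ, at most the last one of each level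
is thus not paid for, and such a level satisfies A(k, k) ≤ |S|, so k ≤ α(|S|). The other nodes
satisfy A(ρ, ρ) ≤ |S|, so ρ ≤ α(|S|), and their ranks are distinct. Hence all but 2α(|S|) + 2 path
nodes pay for themselves (`Forest.potential_compress`). It suffices here that the rank of a root is
less than the size of its set; no logarithmic bound is needed.

A root carries a quadratic potential in its rank. On a `link` this pays for the at most ρ(ρ + 2)
thresholds of the new child, for a possible increase of the other rank, and for comparing two unary
ranks in lockstep (`Forest.potential_link`).

On the machine, `Represents` is the invariant, the `halts_` lemmas execute the programs
symbolically, and `exists_performs` combines them with the potential. Determinism carries the bound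
over to every history. -/

theorem ack_succ_eq_iterate (k n : ℕ) : ack (k + 1) n = (ack k)^[n + 1] 1 := by
  induction n with
  | zero => simp
  | succ n ih => rw [ack_succ_succ, ih, Function.iterate_succ_apply' _ (n + 1)]

theorem ack_diag_strictMono : StrictMono fun k => ack k k :=
  strictMono_nat_of_lt_succ fun k =>
    (ack_strictMono_right k (Nat.lt_succ_self k)).trans_le
      (ack_mono_left (k + 1) (Nat.le_succ k))

theorem invAck_spec (n : ℕ) : 1 ≤ invAck n ∧ n ≤ ack (invAck n) (invAck n) := by
  have h : {k | 1 ≤ k ∧ n ≤ ack k k}.Nonempty :=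
    ⟨n + 1, by omega, (Nat.le_succ n).trans (lt_ack_left _ _).le⟩
  exact Nat.sInf_mem h

theorem le_invAck {k n : ℕ} (h : ack k k ≤ n) : k ≤ invAck n :=
  ack_diag_strictMono.le_iff_le.mp (h.trans (invAck_spec n).2)

/-- The thresholds that the rank `σ` of the parent of a node of rank `ρ` has not yet reached. -/
def thresholds (ρ σ : ℕ) : Finset (ℕ × ℕ) :=
  {q ∈ Finset.range ρ ×ˢ Finset.range (ρ + 2) | σ < (ack q.1)^[q.2] ρ}

theorem card_thresholds_le (ρ σ : ℕ) : (thresholds ρ σ).card ≤ ρ * (ρ + 2) :=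
  (Finset.card_filter_le _ _).trans (by simp)

theorem thresholds_antitone (ρ : ℕ) {σ σ' : ℕ} (h : σ ≤ σ') :
    thresholds ρ σ' ⊆ thresholds ρ σ := by
  intro q hq
  simp only [thresholds, Finset.mem_filter] at hq ⊢
  exact ⟨hq.1, h.trans_lt hq.2⟩

/-- Let A_k^(j+1)(ρ) be the first iterate above σ. Then A_k^j(ρ) ≤ σ, so A_k^(j+1)(ρ) ≤ A_k(σ) ≤ σ':
the pair (k, j + 1) is a threshold for σ but no longer for σ'. -/
theorem card_thresholds_lt {k ρ σ σ' : ℕ} (hk : k < ρ) (hρ : ρ ≤ σ) (hσ : σ < ack (k + 1) ρ)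
    (hσ' : ack k σ ≤ σ') : (thresholds ρ σ').card < (thresholds ρ σ).card := by
  have hmono : Monotone (ack k) := ack_mono_right k
  have hex : ∃ j, σ < (ack k)^[j] ρ := by
    refine ⟨ρ + 1, hσ.trans_le ?_⟩
    rw [ack_succ_eq_iterate]
    exact hmono.iterate (ρ + 1) (by omega)
  -- A(k + 1, ρ) is the (ρ + 1)-st iterate of `ack k` at 1 ≤ ρ. Hence exponents up to ρ + 1 suffice,
  -- which is the reason for `ρ + 2` in `thresholds`.
  have hle : Nat.find hex ≤ ρ + 1 := by
    refine Nat.find_min' hex (hσ.trans_le ?_)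
    rw [ack_succ_eq_iterate]
    exact hmono.iterate (ρ + 1) (by omega)
  have hspec := Nat.find_spec hex
  have hmin := fun j => @Nat.find_min _ _ hex j
  generalize Nat.find hex = j at hle hspec hmin
  obtain _ | j := j
  · simp at hspec; omega
  refine Finset.card_lt_card (Finset.ssubset_iff_of_subset (thresholds_antitone ρ
    ((lt_ack_right k σ).le.trans hσ')) |>.mpr ⟨(k, j + 1), ?_, ?_⟩)
  · simp only [thresholds, Finset.mem_filter, Finset.mem_product, Finset.mem_range]
    exact ⟨⟨hk, by omega⟩, hspec⟩
  · simp only [thresholds, Finset.mem_filter, not_and, not_lt]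
    intro _
    rw [Function.iterate_succ_apply']
    exact (hmono (not_lt.mp (hmin j (Nat.lt_succ_self j)))).trans hσ'

/-- The greatest `k` such that `ack k ρ ≤ σ`. -/
def level (ρ σ : ℕ) : ℕ := Nat.findGreatest (fun k => ack k ρ ≤ σ) σ

theorem ack_level_le {ρ σ : ℕ} (h : ρ < σ) : ack (level ρ σ) ρ ≤ σ :=
  Nat.findGreatest_spec (P := fun k => ack k ρ ≤ σ) (Nat.zero_le σ) (by simpa using h)

/-- The search bound σ in `level` excludes nothing, because k < A(k, ρ). -/
theorem lt_ack_succ_level (ρ σ : ℕ) : σ < ack (level ρ σ + 1) ρ := by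
  by_contra! h
  have h1 : level ρ σ + 1 ≤ σ := (lt_ack_left _ _).le.trans h
  exact Nat.findGreatest_is_greatest (P := fun k => ack k ρ ≤ σ) (Nat.lt_succ_self _) h1 h

/-! ### Ranked forests -/

/-- The parent function `p` and the ranks `rk` represent the set system `S`. -/
structure Forest (S : SetSystem) (p : Node → Node) (rk : Node → ℕ) : Prop where
  par_mem : ∀ x ∈ S.elems, p x ∈ S.elems
  rk_lt : ∀ x ∈ S.elems, p x ≠ x → rk x < rk (p x)
  rep_mem : ∀ x ∈ S.elems, S.rep x ∈ S.elems
  par_rep : ∀ x ∈ S.elems, p (S.rep x) = S.rep x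
  rep_par : ∀ x ∈ S.elems, S.rep (p x) = S.rep x
  rep_root : ∀ x ∈ S.elems, p x = x → S.rep x = x
  rk_lt_card : ∀ x ∈ S.elems, p x = x → rk x < (S.setOf x).card

/-- The potential of a root of rank `n`. -/
def rootPotential (n : ℕ) : ℕ := 2 * n ^ 2 + 9 * n + 14

/-- The potential of a node in a ranked forest. -/
def nodePotential (p : Node → Node) (rk : Node → ℕ) (x : Node) : ℕ :=
  if p x = x then rootPotential (rk x) else (thresholds (rk x + 1) (rk (p x) + 1)).card

/-- The potential of a ranked forest. -/
def potential (E : Finset Node) (p : Node → Node) (rk : Node → ℕ) : ℕ :=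
  ∑ x ∈ E, nodePotential p rk x

/-- `L` lists the nodes on the path from `x` to the root `z`, without `z`. -/
def IsPath (p : Node → Node) (z : Node) : Node → List Node → Prop
  | x, [] => x = z
  | x, y :: L => x = y ∧ x ≠ z ∧ p x ≠ x ∧ IsPath p z (p x) L

theorem IsPath.congr {p p' : Node → Node} {z : Node} {x : Node} {L : List Node}
    (h : ∀ u ∈ L, p' u = p u) (hp : IsPath p z x L) : IsPath p' z x L := by
  induction L generalizing x with
  | nil => exact hp
  | cons y L ih =>
    obtain ⟨rfl, h1, h2, h3⟩ := hp
    have := h x (by simp)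
    exact ⟨rfl, h1, by rwa [this], by rw [this]; exact ih (fun u hu => h u (by simp [hu])) h3⟩

/-! ### The operations on ranked forests and their effect on the potential -/

namespace Forest

variable {S : SetSystem} {p p' : Node → Node} {rk : Node → ℕ} {x z : Node} {L : List Node}

theorem rk_le_par (hF : Forest S p rk) (hx : x ∈ S.elems) : rk x ≤ rk (p x) := by
  by_cases h : p x = x
  · rw [h]
  · exact (hF.rk_lt x hx h).le

theorem exists_isPath (hF : Forest S p rk) (hx : x ∈ S.elems) :
    ∃ L, IsPath p (S.rep x) x L := by
  -- Ranks increase strictly towards the root, so the distance to the maximal rank decreases.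
  induction hn : S.elems.sup rk - rk x using Nat.strong_induction_on generalizing x with
  | _ n ih =>
    by_cases h : p x = x
    · exact ⟨[], (hF.rep_root x hx h).symm⟩
    · have h1 := hF.rk_lt x hx h
      have h2 : rk (p x) ≤ S.elems.sup rk := Finset.le_sup (hF.par_mem x hx)
      obtain ⟨L, hL⟩ := ih _ (by omega) (hF.par_mem x hx) rfl
      rw [hF.rep_par x hx] at hL
      exact ⟨x :: L, rfl, fun h3 => h (h3 ▸ hF.par_rep x hx), h, hL⟩

/-- Monotonicity of ranks along the path. The pairwise statement, that the parent of an earlier node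
has at most the rank of a later node, is what lets two nodes of equal level be compared. -/
theorem path_props (hF : Forest S p rk) (hx : x ∈ S.elems) (hL : IsPath p z x L) :
    rk x ≤ rk z ∧ L.Pairwise (fun u v => rk (p u) ≤ rk v) ∧
    ∀ u ∈ L, u ∈ S.elems ∧ S.rep u = S.rep x ∧ p u ≠ u ∧ rk x ≤ rk u ∧ rk (p u) ≤ rk z := by
  induction L generalizing x with
  | nil => cases hL; simp
  | cons y L ih =>
    obtain ⟨rfl, h1, h2, h3⟩ := hL
    obtain ⟨ha, hb, hc⟩ := ih (hF.par_mem x hx) h3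
    have hlt := hF.rk_lt x hx h2
    refine ⟨by omega, List.pairwise_cons.mpr ⟨fun v hv => (hc v hv).2.2.2.1, hb⟩, ?_⟩
    intro u hu
    rcases List.mem_cons.mp hu with rfl | hu
    · exact ⟨hx, rfl, h2, le_rfl, ha⟩
    · obtain ⟨c1, c2, c3, c4, c5⟩ := hc u hu
      exact ⟨c1, by rw [c2, hF.rep_par x hx], c3, by omega, c5⟩

theorem path_nodup (hF : Forest S p rk) (hx : x ∈ S.elems) (hL : IsPath p z x L) :
    L.Nodup := by
  obtain ⟨-, hb, hc⟩ := hF.path_props hx hL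
  refine (List.Pairwise.and_mem.mp hb).imp ?_
  rintro u v ⟨hu, hv, h⟩ rfl
  have := hF.rk_lt u (hc u hu).1 (hc u hu).2.2.1
  omega

/-- Path compression preserves the invariants of a forest. -/
theorem compress (hF : Forest S p rk) (hx : x ∈ S.elems) (hL : IsPath p (S.rep x) x L)
    (h' : ∀ u ∈ S.elems, p' u = if u ∈ L then S.rep x else p u) : Forest S p' rk := by
  obtain ⟨-, -, hc⟩ := hF.path_props hx hL
  have hroot : ∀ u ∈ S.elems, p' u = u → p u = u := by
    intro u hu h
    rw [h' u hu] at h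
    split_ifs at h with h1
    · rw [← h, hF.par_rep x hx]
    · exact h
  constructor
  · intro u hu
    rw [h' u hu]
    split_ifs
    · exact hF.rep_mem x hx
    · exact hF.par_mem u hu
  · intro u hu hne
    rw [h' u hu] at hne ⊢
    split_ifs at hne ⊢ with h1
    · exact (hF.rk_lt u hu (hc u h1).2.2.1).trans_le (hc u h1).2.2.2.2
    · exact hF.rk_lt u hu hne
  · exact hF.rep_mem
  · intro u hu
    rw [h' _ (hF.rep_mem u hu), if_neg]
    · exact hF.par_rep u hu
    · exact fun h => (hc _ h).2.2.1 (hF.par_rep u hu)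
  · intro u hu
    rw [h' u hu]
    split_ifs with h1
    · rw [(hc u h1).2.1]
      exact hF.rep_root _ (hF.rep_mem x hx) (hF.par_rep x hx)
    · exact hF.rep_par u hu
  · exact fun u hu h => hF.rep_root u hu (hroot u hu h)
  · exact fun u hu h => hF.rk_lt_card u hu (hroot u hu h)

/-- The amortized length of the path that is compressed. -/
theorem potential_compress (hF : Forest S p rk) (hx : x ∈ S.elems)
    (hL : IsPath p (S.rep x) x L)
    (h' : ∀ u ∈ S.elems, p' u = if u ∈ L then S.rep x else p u) :
    potential S.elems p' rk + L.length ≤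
      potential S.elems p rk + 2 * invAck (S.setOf x).card + 2 := by
  obtain ⟨-, hb, hc⟩ := hF.path_props hx hL
  have hnd := hF.path_nodup hx hL
  set z := S.rep x
  set a := invAck (S.setOf x).card
  have hzE := hF.rep_mem x hx
  have hsize : rk z + 1 ≤ (S.setOf x).card := by
    have h1 := hF.rk_lt_card z hzE (hF.par_rep x hx)
    have h2 : S.setOf z = S.setOf x := by
      simp only [SetSystem.setOf]
      rw [hF.rep_root z hzE (hF.par_rep x hx)]
    rwa [h2] at h1
  have hnode : ∀ u ∈ L, nodePotential p rk u = (thresholds (rk u + 1) (rk (p u) + 1)).card ∧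
      nodePotential p' rk u = (thresholds (rk u + 1) (rk z + 1)).card := by
    intro u hu
    obtain ⟨c1, c2, c3, c4, c5⟩ := hc u hu
    have h1 : p' u = z := by rw [h' u c1, if_pos hu]
    have h2 : z ≠ u := by
      rintro h
      have := hF.rk_lt u c1 c3
      rw [← h] at this c5
      omega
    exact ⟨if_neg c3, by rw [nodePotential, h1, if_neg h2]⟩
  -- Ranks are shifted by one throughout, so that the Ackermann function is iterated from a positive
  -- argument.
  let lv : Node → ℕ := fun u => level (rk u + 1) (rk (p u) + 1)
  have hlv : ∀ u ∈ L, ack (lv u) (rk u + 1) ≤ rk (p u) + 1 := fun u hu =>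
    ack_level_le (Nat.succ_lt_succ (hF.rk_lt u (hc u hu).1 (hc u hu).2.2.1))
  have : Std.Symm fun u v => rk (p u) ≤ rk v ∨ rk (p v) ≤ rk u := ⟨fun _ _ => Or.symm⟩
  have hord : ∀ u ∈ L, ∀ v ∈ L, u ≠ v → rk (p u) ≤ rk v ∨ rk (p v) ≤ rk u :=
    fun u hu v hv hne =>
      List.Pairwise.forall (R := fun u v => rk (p u) ≤ rk v ∨ rk (p v) ≤ rk u)
        (hb.imp Or.inl) hu hv hne
  -- The path nodes that do not lose potential; only these have to be paid for by the operation.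
  let B : Finset Node := {u ∈ L.toFinset | nodePotential p rk u ≤ nodePotential p' rk u}
  have hBL : ∀ u ∈ B, u ∈ L := fun u hu => List.mem_toFinset.mp (Finset.mem_filter.mp hu).1
  let B₁ : Finset Node := {u ∈ B | lv u < rk u + 1}
  let B₂ : Finset Node := {u ∈ B | ¬ lv u < rk u + 1}
  -- The level is injective on `B₁`: of two nodes with equal level, the earlier one would lose
  -- potential. It is at most `a` because A(k, k) ≤ A(k, ρ) ≤ σ, which is at most the size of the
  -- set.
  have hB₁ : B₁.card ≤ a + 1 := by
    rw [← Finset.card_range (a + 1)]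
    refine Finset.card_le_card_of_injOn lv ?_ ?_
    · intro u hu
      obtain ⟨h1, h2⟩ := Finset.mem_filter.mp hu
      have h3 := hlv u (hBL u h1)
      have h4 := (hc u (hBL u h1)).2.2.2.2
      have h5 : ack (lv u) (lv u) ≤ ack (lv u) (rk u + 1) := ack_mono_right _ h2.le
      have := le_invAck (k := lv u) (n := (S.setOf x).card) (by omega)
      simp only [Finset.coe_range, Set.mem_Iio]
      omega
    · have key : ∀ u ∈ B₁, ∀ v ∈ B₁, lv u = lv v → rk (p u) ≤ rk v → False := by
        intro u hu v hv huv hle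
        obtain ⟨h1, h2⟩ := Finset.mem_filter.mp hu
        obtain ⟨h3, h4⟩ := Finset.mem_filter.mp hv
        have h5 := (hnode u (hBL u h1))
        have h6 := (Finset.mem_filter.mp h1).2
        rw [h5.1, h5.2] at h6
        refine absurd h6 (not_le.mpr (card_thresholds_lt (k := lv u) h2 ?_
          (lt_ack_succ_level _ _) ?_))
        · have := hF.rk_le_par (hc u (hBL u h1)).1
          omega
        · have h7 := hlv v (hBL v h3)
          have h8 := (hc v (hBL v h3)).2.2.2.2
          have h9 : ack (lv u) (rk (p u) + 1) ≤ ack (lv v) (rk v + 1) := by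
            rw [huv]; exact ack_mono_right _ (by omega)
          omega
      intro u hu v hv huv
      by_contra hne
      rcases hord u (hBL u (Finset.mem_filter.mp hu).1) v (hBL v (Finset.mem_filter.mp hv).1) hne
        with h | h
      · exact key u hu v hv huv h
      · exact key v hv u hu huv.symm h
  -- Here ρ is at most the level, so A(ρ, ρ) ≤ σ bounds ρ by `a`, and ranks on a path are distinct.
  have hB₂ : B₂.card ≤ a + 1 := by
    rw [← Finset.card_range (a + 1)]
    refine Finset.card_le_card_of_injOn rk ?_ ?_
    · intro u hu
      obtain ⟨h1, h2⟩ := Finset.mem_filter.mp hu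
      have h3 := hlv u (hBL u h1)
      have h4 := (hc u (hBL u h1)).2.2.2.2
      have h5 : ack (rk u + 1) (rk u + 1) ≤ ack (lv u) (rk u + 1) :=
        ack_mono_left _ (not_lt.mp h2)
      have := le_invAck (k := rk u + 1) (n := (S.setOf x).card) (by omega)
      simp only [Finset.coe_range, Set.mem_Iio]
      omega
    · intro u hu v hv huv
      by_contra hne
      have h1 := hBL u (Finset.mem_filter.mp hu).1
      have h2 := hBL v (Finset.mem_filter.mp hv).1
      have h3 := hF.rk_lt u (hc u h1).1 (hc u h1).2.2.1
      have h4 := hF.rk_lt v (hc v h2).1 (hc v h2).2.2.1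
      rcases hord u h1 v h2 hne with h | h <;> omega
  have hB : B.card ≤ 2 * a + 2 := by
    have : B₁.card + B₂.card = B.card := Finset.card_filter_add_card_filter_not _
    omega
  have hsub : L.toFinset ⊆ S.elems := fun u hu => (hc u (List.mem_toFinset.mp hu)).1
  have hlen : L.length = ∑ u ∈ S.elems, if u ∈ L then 1 else 0 := by
    rw [← List.toFinset_card_of_nodup hnd, Finset.sum_boole, Nat.cast_id]
    congr 1
    ext u
    simp only [List.mem_toFinset, Finset.mem_filter]
    exact ⟨fun h => ⟨(hc u h).1, h⟩, fun h => h.2⟩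
  have hBsum : B.card = ∑ u ∈ S.elems, if u ∈ B then 1 else 0 := by
    rw [Finset.sum_boole, Nat.cast_id]
    congr 1
    ext u
    simp only [Finset.mem_filter]
    exact ⟨fun h => ⟨(hc u (hBL u h)).1, h⟩, fun h => h.2⟩
  have hmain : potential S.elems p' rk + L.length ≤ potential S.elems p rk + B.card := by
    rw [hlen, hBsum, potential, potential, ← Finset.sum_add_distrib, ← Finset.sum_add_distrib]
    refine Finset.sum_le_sum fun u hu => ?_
    by_cases h1 : u ∈ L
    · rw [if_pos h1]
      by_cases h2 : u ∈ B
      · rw [if_pos h2, (hnode u h1).1, (hnode u h1).2]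
        have := Finset.card_le_card (thresholds_antitone (rk u + 1)
          (Nat.succ_le_succ (hc u h1).2.2.2.2))
        simp only [Nat.succ_eq_add_one] at this
        omega
      · have : ¬ nodePotential p rk u ≤ nodePotential p' rk u := fun h =>
          h2 (Finset.mem_filter.mpr ⟨List.mem_toFinset.mpr h1, h⟩)
        rw [if_neg h2]
        omega
    · rw [if_neg h1, if_neg fun h => h1 (hBL u h)]
      simp [nodePotential, h' u hu, h1]
  omega

/-- Adding a new singleton. -/
theorem addSingleton (hF : Forest S p rk) (hx : x ∉ S.elems) (hpx : p' x = x)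
    (h' : ∀ u ∈ S.elems, p' u = p u) :
    Forest (S.addSingleton x) p' (Function.update rk x 0) := by
  have hne : ∀ u ∈ S.elems, u ≠ x := fun u hu h => hx (h ▸ hu)
  have hrep : ∀ u ∈ S.elems, (S.addSingleton x).rep u = S.rep u := fun u hu => by
    simp [SetSystem.addSingleton, hne u hu]
  have hrepx : (S.addSingleton x).rep x = x := by simp [SetSystem.addSingleton]
  have hmem : ∀ u, u ∈ (S.addSingleton x).elems ↔ u = x ∨ u ∈ S.elems := fun u => by
    simp [SetSystem.addSingleton]
  have hrk : ∀ u ∈ S.elems, Function.update rk x 0 u = rk u := fun u hu => by simp [hne u hu]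
  constructor <;> intro u hu <;> rcases (hmem u).mp hu with rfl | hu'
  · rwa [hpx]
  · rw [h' u hu', hmem]; exact Or.inr (hF.par_mem u hu')
  · exact fun h => absurd hpx h
  · rw [h' u hu', hrk u hu', hrk _ (hF.par_mem u hu')]; exact hF.rk_lt u hu'
  · rwa [hrepx]
  · rw [hrep u hu', hmem]; exact Or.inr (hF.rep_mem u hu')
  · rw [hrepx, hpx]
  · rw [hrep u hu', h' _ (hF.rep_mem u hu'), hF.par_rep u hu']
  · rw [hpx]
  · rw [h' u hu', hrep u hu', hrep _ (hF.par_mem u hu'), hF.rep_par u hu']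
  · exact fun _ => hrepx
  · rw [h' u hu', hrep u hu']; exact hF.rep_root u hu'
  · intro _
    rw [Function.update_self, Finset.card_pos]
    exact ⟨u, by simp [SetSystem.setOf, hu]⟩
  · rw [h' u hu', hrk u hu']
    intro h
    refine (hF.rk_lt_card u hu' h).trans_le (Finset.card_le_card fun v hv => ?_)
    simp only [SetSystem.setOf, Finset.mem_filter] at hv ⊢
    exact ⟨(hmem v).mpr (Or.inr hv.1), by rw [hrep v hv.1, hrep u hu', hv.2]⟩

theorem potential_addSingleton (hF : Forest S p rk) (hx : x ∉ S.elems) (hpx : p' x = x)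
    (h' : ∀ u ∈ S.elems, p' u = p u) :
    potential (S.addSingleton x).elems p' (Function.update rk x 0) =
      potential S.elems p rk + 14 := by
  have hne : ∀ u ∈ S.elems, u ≠ x := fun u hu h => hx (h ▸ hu)
  rw [potential, potential, SetSystem.addSingleton, Finset.sum_insert hx, add_comm]
  congr 1
  · refine Finset.sum_congr rfl fun u hu => ?_
    simp [nodePotential, h' u hu, hne u hu, hne _ (hF.par_mem u hu)]
  · simp [nodePotential, hpx, rootPotential]

variable {c s : Node} {n : ℕ}

/-- The sets that contain `r` and `r'` are united by making the root `s` the parent of the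
root `c`, where `c` and `s` are `r` and `r'` in some order. -/
theorem link (hF : Forest S p rk) {r r' : Node} (hc : S.IsRep c) (hs : S.IsRep s) (hcs : c ≠ s)
    (hrr : r = c ∧ r' = s ∨ r = s ∧ r' = c)
    (hn : rk c < rk s ∧ n = rk s ∨ rk c = rk s ∧ n = rk s + 1)
    (h' : ∀ u ∈ S.elems, p' u = if u = c then s else p u) :
    Forest (S.merge r r' s) p' (Function.update rk s n) := by
  have hpc : p c = c := by have := hF.par_rep c hc.1; rwa [hc.2] at this
  have hps : p s = s := by have := hF.par_rep s hs.1; rwa [hs.2] at this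
  have hrep : ∀ u, (S.merge r r' s).rep u = if S.rep u = c ∨ S.rep u = s then s else S.rep u := by
    intro u
    rcases hrr with ⟨rfl, rfl⟩ | ⟨rfl, rfl⟩ <;> simp [SetSystem.merge, hc.2, hs.2, or_comm]
  have hE : (S.merge r r' s).elems = S.elems := rfl
  have hroot : ∀ u ∈ S.elems, p' u = u → p u = u ∧ u ≠ c := by
    intro u hu h
    rw [h' u hu] at h
    split_ifs at h with h1
    · exact absurd (h1 ▸ h).symm hcs
    · exact ⟨h, h1⟩
  have hrk : ∀ u, rk u ≤ Function.update rk s n u := by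
    intro u
    by_cases h : u = s
    · subst h; rw [Function.update_self]; omega
    · rw [Function.update_of_ne h]
  constructor <;> rw [hE]
  · intro u hu
    rw [h' u hu]
    split_ifs
    · exact hs.1
    · exact hF.par_mem u hu
  · intro u hu h
    rw [h' u hu] at h ⊢
    split_ifs at h ⊢ with h1
    · subst h1
      rw [Function.update_self, Function.update_of_ne hcs]
      omega
    · have hus : u ≠ s := fun h2 => h (h2 ▸ hps)
      rw [Function.update_of_ne hus]
      exact (hF.rk_lt u hu h).trans_le (hrk _)
  · intro u hu
    rw [hrep]
    split_ifs
    · exact hs.1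
    · exact hF.rep_mem u hu
  · intro u hu
    rw [hrep]
    split_ifs with h1
    · rw [h' s hs.1, if_neg hcs.symm, hps]
    · rw [h' _ (hF.rep_mem u hu), if_neg fun h => h1 (Or.inl h), hF.par_rep u hu]
  · intro u hu
    rw [h' u hu]
    split_ifs with h1
    · subst h1; rw [hrep, hrep, hs.2, hc.2]; simp
    · rw [hrep, hrep, hF.rep_par u hu]
  · intro u hu h
    obtain ⟨h1, h2⟩ := hroot u hu h
    rw [hrep, hF.rep_root u hu h1]
    split_ifs with h3
    · exact (h3.resolve_left h2).symm
    · rfl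
  · intro u hu h
    obtain ⟨h1, h2⟩ := hroot u hu h
    have hsub : ∀ v, S.setOf v ⊆ (S.merge r r' s).setOf v := by
      intro v w hw
      simp only [SetSystem.setOf, Finset.mem_filter] at hw ⊢
      exact ⟨hw.1, by rw [hrep, hrep, hw.2]⟩
    by_cases hus : u = s
    · subst hus
      have h3 := hF.rk_lt_card c hc.1 hpc
      have h4 := hF.rk_lt_card u hs.1 hps
      -- The sizes of the two sets add up. If both ranks equal k, each size exceeds k, so the sum
      -- exceeds k + 1.
      have h5 : Disjoint (S.setOf c) (S.setOf u) := by
        rw [Finset.disjoint_left]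
        intro v hv hv'
        simp only [SetSystem.setOf, Finset.mem_filter, hc.2, hs.2] at hv hv'
        exact hcs (hv.2.symm.trans hv'.2)
      have h6 : S.setOf c ∪ S.setOf u ⊆ (S.merge r r' u).setOf u := by
        refine Finset.union_subset (fun v hv => ?_) (hsub u)
        simp only [SetSystem.setOf, Finset.mem_filter, hc.2] at hv ⊢
        exact ⟨hv.1, by rw [hrep, hrep, hv.2, hs.2]; simp⟩
      have h7 := Finset.card_le_card h6
      rw [Finset.card_union_of_disjoint h5] at h7
      rw [Function.update_self]
      omega
    · rw [Function.update_of_ne hus]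
      exact (hF.rk_lt_card u hu h1).trans_le (Finset.card_le_card (hsub u))

/-- The surplus `rk c` pays for comparing the ranks, which takes time proportional to the smaller
one. -/
theorem potential_link (hF : Forest S p rk) (hc : S.IsRep c) (hs : S.IsRep s) (hcs : c ≠ s)
    (hn : rk c < rk s ∧ n = rk s ∨ rk c = rk s ∧ n = rk s + 1)
    (h' : ∀ u ∈ S.elems, p' u = if u = c then s else p u) :
    potential S.elems p' (Function.update rk s n) + rk c ≤ potential S.elems p rk := by
  have hpc : p c = c := by have := hF.par_rep c hc.1; rwa [hc.2] at this
  have hps : p s = s := by have := hF.par_rep s hs.1; rwa [hs.2] at this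
  have hcs' : c ∈ S.elems.erase s := Finset.mem_erase.mpr ⟨hcs, hc.1⟩
  rw [potential, potential, ← Finset.add_sum_erase _ _ hs.1, ← Finset.add_sum_erase _ _ hcs',
    ← Finset.add_sum_erase _ _ hs.1, ← Finset.add_sum_erase _ _ hcs']
  have h1 : ∑ u ∈ (S.elems.erase s).erase c, nodePotential p' (Function.update rk s n) u ≤
      ∑ u ∈ (S.elems.erase s).erase c, nodePotential p rk u := by
    refine Finset.sum_le_sum fun u hu => ?_
    obtain ⟨h2, h3, h4⟩ : u ≠ c ∧ u ≠ s ∧ u ∈ S.elems := by simpa using hu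
    rw [nodePotential, nodePotential, h' u h4, if_neg h2]
    rw [Function.update_of_ne h3]
    split_ifs
    · exact le_rfl
    · refine Finset.card_le_card (thresholds_antitone _ (Nat.succ_le_succ ?_))
      by_cases h : p u = s
      · rw [h, Function.update_self]; omega
      · rw [Function.update_of_ne h]
  have h2 : nodePotential p' (Function.update rk s n) s = rootPotential n := by
    simp [nodePotential, h' s hs.1, hcs.symm, hps]
  have h3 : nodePotential p' (Function.update rk s n) c ≤ (rk c + 1) * (rk c + 1 + 2) := by
    rw [nodePotential, h' c hc.1, if_pos rfl, if_neg hcs.symm, Function.update_of_ne hcs]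
    exact card_thresholds_le _ _
  have h4 : nodePotential p rk c = rootPotential (rk c) := by simp [nodePotential, hpc]
  have h5 : nodePotential p rk s = rootPotential (rk s) := by simp [nodePotential, hps]
  rw [h2, h4, h5]
  -- The critical case is that of equal ranks k: the left side is 3k² + 18k + 28 and the right side
  -- 4k² + 18k + 28. This dictates the coefficients 9 and 14 of `rootPotential`.
  have h6 : rootPotential n + (rk c + 1) * (rk c + 1 + 2) + rk c ≤
      rootPotential (rk s) + rootPotential (rk c) := by
    rcases hn with ⟨-, rfl⟩ | ⟨h, rfl⟩
    · simp only [rootPotential]; nlinarith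
    · rw [h]; simp only [rootPotential]; nlinarith
  omega

end Forest

end UnionFind

namespace PointerMachine

/-! ### Reasoning about runs -/

variable {D : Type*} {d b w : ℕ}

/-- The memory `m'` arises from `m` by adding nodes. -/
def Memory.Ext (m m' : Memory D d b) : Prop :=
  m.size ≤ m'.size ∧ ∀ u < m.size, m'.content u = m.content u ∧ m'.ptr u = m.ptr u

theorem Memory.Ext.trans {m m' m'' : Memory D d b} (h : m.Ext m') (h' : m'.Ext m'') :
    m.Ext m'' :=
  ⟨h.1.trans h'.1, fun u hu =>
    ⟨(h'.2 u (hu.trans_le h.1)).1.trans (h.2 u hu).1,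
      (h'.2 u (hu.trans_le h.1)).2.trans (h.2 u hu).2⟩⟩

theorem Memory.ext_alloc (m : Memory D d b) (c : D ⊕ Word b) : m.Ext (m.alloc c) :=
  ⟨Nat.le_succ _, fun u hu => by simp [Memory.alloc, hu.ne]⟩

variable [LinearOrder D]

/-- A history may contain any successful run; by determinism it is the one constructed below. -/
theorem Runs.deterministic {P : Program d b w} {c c' c'' : Config D d b w} {t s : ℕ}
    (h : Runs P c t c') (h' : Runs P c s c'') : t = s ∧ c' = c'' := by
  induction h generalizing s with
  | halt h =>
    cases h' with
    | halt => exact ⟨rfl, rfl⟩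
    | step h1 h2 =>
      rw [h] at h1
      cases h1
      simp [Instr.exec] at h2
  | step h1 h2 _ ih =>
    cases h' with
    | halt h3 =>
      rw [h3] at h1
      cases h1
      simp [Instr.exec] at h2
    | step h3 h4 h5 =>
      rw [h1] at h3
      cases h3
      rw [h2] at h4
      cases h4
      obtain ⟨rfl, rfl⟩ := ih h5
      exact ⟨rfl, rfl⟩

theorem Call.deterministic {P : Program d b w} {m m' m'' : Memory D d b} {args : List Node}
    {t s : ℕ} {x y : Node} (h : Call P m args t m' x) (h' : Call P m args s m'' y) :
    t = s ∧ m' = m'' ∧ x = y := by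
  obtain ⟨c, hr, rfl, rfl⟩ := h
  obtain ⟨c', hr', rfl, rfl⟩ := h'
  obtain ⟨rfl, rfl⟩ := hr.deterministic hr'
  exact ⟨rfl, rfl, rfl⟩

/-- From `c` the program `P` halts after at most `T` instructions, with memory and output as
described by `Q`. -/
def Halts (P : Program d b w) (c : Config D d b w) (T : ℕ) (Q : Memory D d b → Node → Prop) :
    Prop :=
  ∃ t c', t ≤ T ∧ Runs P c t c' ∧ Q c'.mem (c'.cell 0)

variable {P : Program d b w} {m : Memory D d b} {pc T T' : ℕ} {v : Fin (w + 3) → Node}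
  {Q : Memory D d b → Node → Prop} {i j r : Fin (w + 3)} {q : Fin d}

theorem Halts.exists_call {args : List Node}
    (h : Halts P ⟨0, m, fun i => (root :: args).getD i root⟩ T Q) :
    ∃ t ≤ T, ∃ m' out, Call P m args t m' out ∧ Q m' out := by
  obtain ⟨t, c', h1, h2, h3⟩ := h
  exact ⟨t, h1, c'.mem, c'.cell 0, ⟨c', h2, rfl, rfl⟩, h3⟩

theorem Halts.mono {c : Config D d b w} (h : Halts P c T Q) (hT : T ≤ T') : Halts P c T' Q := by
  obtain ⟨t, c', h1, h2⟩ := h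
  exact ⟨t, c', h1.trans hT, h2⟩

/-- This rule and its instances below work backwards from the postcondition. A symbolic execution is
a nested term of such rules, where `rfl` looks up each instruction. -/
theorem Halts.step {c c₁ : Config D d b w} {I : Instr d b w} (h : P[c.pc]? = some I)
    (hc : I.exec c = some c₁) (H : Halts P c₁ T Q) : Halts P c (T + 1) Q := by
  obtain ⟨t, c', h1, h2, h3⟩ := H
  exact ⟨t + 1, c', Nat.succ_le_succ h1, .step h hc h2, h3⟩

theorem Halts.halt (h : P[pc]? = some .halt) (hQ : Q m (v 0)) : Halts P ⟨pc, m, v⟩ 1 Q :=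
  ⟨1, _, le_rfl, .halt h, hQ⟩

theorem Halts.copy (h : P[pc]? = some (.copy r i))
    (H : Halts P ⟨pc + 1, m, Function.update v r (v i)⟩ T Q) :
    Halts P ⟨pc, m, v⟩ (T + 1) Q := .step h rfl H

theorem Halts.traverse (h : P[pc]? = some (.traverse r q))
    (H : Halts P ⟨pc + 1, m, Function.update v r (m.ptr (v r) q)⟩ T Q) :
    Halts P ⟨pc, m, v⟩ (T + 1) Q := .step h rfl H

theorem Halts.store (h : P[pc]? = some (.store i q j))
    (H : Halts P ⟨pc + 1, m.setPtr (v i) q (v j), v⟩ T Q) :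
    Halts P ⟨pc, m, v⟩ (T + 1) Q := .step h rfl H

theorem Halts.create (h : P[pc]? = some (.create r))
    (H : Halts P ⟨pc + 1, m.alloc (Sum.inr fun _ => false), Function.update v r m.size⟩ T Q) :
    Halts P ⟨pc, m, v⟩ (T + 1) Q := .step h rfl H

/-- An unconditional jump. -/
theorem Halts.jump {e : Fin b} {k : ℕ} (h : P[pc]? = some (.branch i e k k))
    (hi : (m.content (v i)).isRight) (H : Halts P ⟨k, m, v⟩ T Q) :
    Halts P ⟨pc, m, v⟩ (T + 1) Q := by
  refine .step h (c₁ := ⟨k, m, v⟩) ?_ H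
  obtain ⟨u, hu⟩ := Sum.isRight_iff.mp hi
  simp [Instr.exec, hu]

/-- A conditional jump on the identity of two nodes. -/
theorem Halts.branchSame {e : Fin b} {yes no : ℕ} (h : P[pc]? = some (.sameNode r i j))
    (h' : P[pc + 1]? = some (.branch r e yes no))
    (hij : (m.content (v i)).isLeft = (m.content (v j)).isLeft)
    (H : ∀ m' a, m.Ext m' → (m'.content a).isRight →
      Halts P ⟨if v i = v j then yes else no, m', Function.update v r a⟩ T Q) :
    Halts P ⟨pc, m, v⟩ (T + 2) Q := by
  -- The new node storing the outcome is the witness `a`; the continuation learns only that memory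
  -- was extended.
  have H' := H (m.alloc (Sum.inr fun _ => decide (v i = v j))) m.size (m.ext_alloc _)
    (by simp [Memory.alloc])
  refine .step h (c₁ := (⟨pc, m, v⟩ : Config D d b w).emit r fun _ => decide (v i = v j))
    (by simp only [Instr.exec, hij, if_true]) (.step h' ?_ H')
  simp [Instr.exec, Config.emit, Memory.alloc]

end PointerMachine

namespace UnionFind

open PointerMachine

/-! ### The programs

Pointer `0` of a data node points to its parent. Pointer `1` of a root points to its rank in unary,
a chain of pointer nodes. Pointer `2` links all data nodes to a list that starts at the root of the
memory. The last node of a chain points to itself. -/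

/-- Unassigned pointers are self-loops, so the new data node is already its own parent, and the
created pointer node is already a chain for rank `0`. -/
def makeSetProgram : Program 3 1 3 :=
  [.copy 2 0, .traverse 2 2, .store 1 2 2, .store 0 2 1, .create 3, .store 1 1 3, .copy 0 1, .halt]

def findProgram : Program 3 1 3 :=
  [.copy 3 1,
    -- the root of the tree goes to cell `2`
    .copy 2 3, .traverse 3 0, .sameNode 4 2 3, .branch 4 0 5 1,
    -- path compression
    .sameNode 4 1 2, .branch 4 0 12 7, .copy 3 1, .traverse 3 0, .store 1 0 2, .copy 1 3,
    .branch 4 0 5 5,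
    .copy 0 2, .halt]

def linkProgram : Program 3 1 3 :=
  [.copy 3 1, .traverse 3 1, .copy 4 2, .traverse 4 1,
    -- follow both chains until one of them ends
    .copy 5 3, .traverse 5 0, .sameNode 0 3 5, .branch 0 0 15 8,
    .copy 3 5, .copy 5 4, .traverse 5 0, .sameNode 0 4 5, .branch 0 0 27 13,
    .copy 4 5, .branch 0 0 4 4,
    .copy 5 4, .traverse 5 0, .sameNode 0 4 5, .branch 0 0 19 24,
    -- equal ranks
    .create 5, .copy 3 2, .traverse 3 1, .store 5 0 3, .store 2 1 5,
    -- the first root becomes a child of the second one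
    .store 1 0 2, .copy 0 2, .halt,
    -- the second root becomes a child of the first one
    .store 2 0 1, .copy 0 1, .halt]

/-- Link by rank with path compression. -/
def linkByRank : Implementation := ⟨3, 1, 3, makeSetProgram, linkProgram, findProgram⟩

/-! ### Updates of an explicitly listed working memory -/

section Cells

variable (a₀ a₁ a₂ a₃ a₄ a₅ x : Node)

theorem update_cell_zero :
    Function.update (![a₀, a₁, a₂, a₃, a₄, a₅] : Fin (3 + 3) → Node) 0 x =
      ![x, a₁, a₂, a₃, a₄, a₅] := by
  ext i; fin_cases i <;> rfl

theorem update_cell_one :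
    Function.update (![a₀, a₁, a₂, a₃, a₄, a₅] : Fin (3 + 3) → Node) 1 x =
      ![a₀, x, a₂, a₃, a₄, a₅] := by
  ext i; fin_cases i <;> rfl

theorem update_cell_two :
    Function.update (![a₀, a₁, a₂, a₃, a₄, a₅] : Fin (3 + 3) → Node) 2 x =
      ![a₀, a₁, x, a₃, a₄, a₅] := by
  ext i; fin_cases i <;> rfl

theorem update_cell_three :
    Function.update (![a₀, a₁, a₂, a₃, a₄, a₅] : Fin (3 + 3) → Node) 3 x =
      ![a₀, a₁, a₂, x, a₄, a₅] := by
  ext i; fin_cases i <;> rfl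

theorem update_cell_four :
    Function.update (![a₀, a₁, a₂, a₃, a₄, a₅] : Fin (3 + 3) → Node) 4 x =
      ![a₀, a₁, a₂, a₃, x, a₅] := by
  ext i; fin_cases i <;> rfl

theorem update_cell_five :
    Function.update (![a₀, a₁, a₂, a₃, a₄, a₅] : Fin (3 + 3) → Node) 5 x =
      ![a₀, a₁, a₂, a₃, a₄, x] := by
  ext i; fin_cases i <;> rfl

end Cells

/-! ### Set systems represented in memory -/

variable {D : Type*}

/-- `x` is the first node of a chain of `n + 1` pointer nodes. -/
def Chain (m : Memory D 3 1) : ℕ → Node → Prop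
  | 0, x => x < m.size ∧ (m.content x).isRight ∧ m.ptr x 0 = x
  | n + 1, x => x < m.size ∧ (m.content x).isRight ∧ m.ptr x 0 ≠ x ∧ Chain m n (m.ptr x 0)

theorem Chain.lt_size {m : Memory D 3 1} {n : ℕ} {x : Node} (h : Chain m n x) :
    x < m.size := by
  cases n <;> exact h.1

theorem Chain.isRight {m : Memory D 3 1} {n : ℕ} {x : Node} (h : Chain m n x) :
    (m.content x).isRight := by
  cases n <;> exact h.2.1

theorem Chain.ptr_isRight {m : Memory D 3 1} {n : ℕ} {x : Node} (h : Chain m n x) :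
    (m.content (m.ptr x 0)).isRight := by
  cases n with
  | zero => rw [h.2.2]; exact h.2.1
  | succ n => exact h.2.2.2.isRight

theorem isLeft_eq_of_isRight {α β : Type*} {x y : α ⊕ β} (hx : x.isRight) (hy : y.isRight) :
    x.isLeft = y.isLeft := by
  cases x <;> cases y <;> simp_all

theorem Chain.isLeft_eq {m : Memory D 3 1} {n : ℕ} {x : Node} (h : Chain m n x) :
    (m.content x).isLeft = (m.content (m.ptr x 0)).isLeft :=
  isLeft_eq_of_isRight h.isRight h.ptr_isRight

/-- Programs redirect pointer `0` only at data nodes and at a newly created rank node, so existing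
chains survive every operation. -/
theorem Chain.congr {m m' : Memory D 3 1} {n : ℕ} {x : Node} (hs : m.size ≤ m'.size)
    (hm : ∀ u < m.size, (m.content u).isRight → (m'.content u).isRight ∧ m'.ptr u 0 = m.ptr u 0)
    (h : Chain m n x) : Chain m' n x := by
  induction n generalizing x with
  | zero =>
    obtain ⟨h1, h2, h3⟩ := h
    exact ⟨h1.trans_le hs, (hm x h1 h2).1, by rw [(hm x h1 h2).2, h3]⟩
  | succ n ih =>
    obtain ⟨h1, h2, h3, h4⟩ := h
    exact ⟨h1.trans_le hs, (hm x h1 h2).1, by rwa [(hm x h1 h2).2],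
      by rw [(hm x h1 h2).2]; exact ih h4⟩

theorem Chain.ext {m m' : Memory D 3 1} {n : ℕ} {x : Node} (h : Chain m n x) (hm : m.Ext m') :
    Chain m' n x :=
  h.congr hm.1 fun u hu hr => ⟨by rwa [(hm.2 u hu).1], by rw [(hm.2 u hu).2]⟩

/-- The memory `m` represents the set system `S`, with ranks `rk`. -/
structure Represents (m : Memory D 3 1) (S : SetSystem) (rk : Node → ℕ) : Prop where
  size_pos : 0 < m.size
  lt_size : ∀ x ∈ S.elems, x < m.size
  isLeft : ∀ x ∈ S.elems, (m.content x).isLeft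
  forest : Forest S (fun x => m.ptr x 0) rk
  chain : ∀ x ∈ S.elems, m.ptr x 0 = x → Chain m (rk x) (m.ptr x 1)
  reach : ∀ x ∈ S.elems,
    Relation.ReflTransGen (fun u v => u < m.size ∧ m.ptr u 2 = v) root x

variable {m m' : Memory D 3 1} {S : SetSystem} {rk : Node → ℕ}

theorem Represents.reachable (hm : Represents m S rk) {x : Node} (hx : x ∈ S.elems) :
    m.Reachable root x :=
  Relation.ReflTransGen.mono (fun _ _ h => ⟨2, h.2⟩) _ _ (hm.reach x hx)

theorem represents_init : Represents (Memory.init : Memory D 3 1) .empty fun _ => 0 := by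
  constructor <;> simp [SetSystem.empty, Memory.init]
  constructor <;> simp

/-- The guard `u < m.size` keeps the list within allocated nodes, which later allocations do not
affect. -/
theorem reach_congr (hs : m.size ≤ m'.size) (h2 : ∀ u < m.size, m'.ptr u 2 = m.ptr u 2)
    {x y : Node} (h : Relation.ReflTransGen (fun u v => u < m.size ∧ m.ptr u 2 = v) x y) :
    Relation.ReflTransGen (fun u v => u < m'.size ∧ m'.ptr u 2 = v) x y :=
  Relation.ReflTransGen.mono
    (fun u _ huv => ⟨huv.1.trans_le hs, (h2 u huv.1).trans huv.2⟩) _ _ h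

/-- The edge that leaves the memory root is replaced by a detour of two edges through `x`. -/
theorem reach_push {x : Node} (hs : m.size ≤ m'.size) (h0 : root < m.size) (hxs : x < m'.size)
    (hroot : m'.ptr root 2 = x) (hx : m'.ptr x 2 = m.ptr root 2)
    (h2 : ∀ u < m.size, u ≠ root → m'.ptr u 2 = m.ptr u 2) {y : Node}
    (h : Relation.ReflTransGen (fun u v => u < m.size ∧ m.ptr u 2 = v) root y) :
    Relation.ReflTransGen (fun u v => u < m'.size ∧ m'.ptr u 2 = v) root y := by
  induction h with
  | refl => exact .refl
  | @tail u v _ huv ih =>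
    by_cases hu : u = root
    · subst hu
      exact (Relation.ReflTransGen.single ⟨h0.trans_le hs, hroot⟩).tail ⟨hxs, hx.trans huv.2⟩
    · exact ih.tail ⟨huv.1.trans_le hs, (h2 u huv.1 hu).trans huv.2⟩

theorem Represents.addSingleton (hm : Represents m S rk) {x : Node} (hx : m.size ≤ x)
    (hxs : x < m'.size) (hc : ∀ u < m.size, m'.content u = m.content u)
    (hxl : (m'.content x).isLeft) (h0 : ∀ u < m.size, m'.ptr u 0 = m.ptr u 0)
    (hx0 : m'.ptr x 0 = x) (h1 : ∀ u < m.size, m'.ptr u 1 = m.ptr u 1)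
    (hx1 : Chain m' 0 (m'.ptr x 1)) (hroot : m'.ptr root 2 = x)
    (hx2 : m'.ptr x 2 = m.ptr root 2)
    (h2 : ∀ u < m.size, u ≠ root → m'.ptr u 2 = m.ptr u 2) :
    Represents m' (S.addSingleton x) (Function.update rk x 0) := by
  have hs : m.size ≤ m'.size := hx.trans hxs.le
  have hxE : x ∉ S.elems := fun h => absurd (hm.lt_size x h) (not_lt.mpr hx)
  have hmem : ∀ u, u ∈ (S.addSingleton x).elems ↔ u = x ∨ u ∈ S.elems := fun u => by
    simp [SetSystem.addSingleton]
  refine ⟨hm.size_pos.trans_le hs, ?_, ?_, hm.forest.addSingleton hxE hx0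
    (fun u hu => h0 u (hm.lt_size u hu)), ?_, ?_⟩ <;> intro u hu <;>
    rcases (hmem u).mp hu with rfl | hu'
  · exact hxs
  · exact (hm.lt_size u hu').trans_le hs
  · exact hxl
  · rw [hc u (hm.lt_size u hu')]; exact hm.isLeft u hu'
  · intro _; rwa [Function.update_self]
  · have hux : u ≠ x := fun h => hxE (h ▸ hu')
    rw [h0 u (hm.lt_size u hu'), h1 u (hm.lt_size u hu'), Function.update_of_ne hux]
    exact fun h => (hm.chain u hu' h).congr hs fun y hy hr => ⟨by rwa [hc y hy], h0 y hy⟩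
  · exact .single ⟨hm.size_pos.trans_le hs, hroot⟩
  · exact reach_push hs hm.size_pos hxs hroot hx2 h2 (hm.reach u hu')

/-- Path compression preserves the representation. -/
theorem Represents.compress (hm : Represents m S rk) {x : Node} (hx : x ∈ S.elems)
    {L : List Node} (hL : IsPath (fun u => m.ptr u 0) (S.rep x) x L) (hs : m.size ≤ m'.size)
    (hc : ∀ u < m.size, m'.content u = m.content u)
    (hp : ∀ u < m.size, m'.ptr u =
      if u ∈ L then Function.update (m.ptr u) 0 (S.rep x) else m.ptr u) :
    Represents m' S rk := by
  obtain ⟨-, -, hLE⟩ := hm.forest.path_props hx hL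
  have h0 : ∀ u < m.size, m'.ptr u 0 = if u ∈ L then S.rep x else m.ptr u 0 := by
    intro u hu
    rw [hp u hu]
    split_ifs <;> simp
  have hne : ∀ u < m.size, ∀ i : Fin 3, i ≠ 0 → m'.ptr u i = m.ptr u i := by
    intro u hu i hi
    rw [hp u hu]
    split_ifs <;> simp [hi]
  refine ⟨hm.size_pos.trans_le hs, fun u hu => (hm.lt_size u hu).trans_le hs, ?_,
    hm.forest.compress hx hL fun u hu => h0 u (hm.lt_size u hu), ?_, ?_⟩ <;> intro u hu
  · rw [hc u (hm.lt_size u hu)]; exact hm.isLeft u hu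
  · rw [h0 u (hm.lt_size u hu), hne u (hm.lt_size u hu) 1 (by decide)]
    intro h
    have h' : m.ptr u 0 = u := by
      split_ifs at h
      · rw [← h]; exact hm.forest.par_rep x hx
      · exact h
    refine (hm.chain u hu h').congr hs fun y hy hr => ⟨by rwa [hc y hy], ?_⟩
    rw [h0 y hy, if_neg]
    intro hyL
    have := hm.isLeft y (hLE y hyL).1
    rw [← Sum.not_isRight] at this
    simp [hr] at this
  · exact reach_congr hs (fun y hy => hne y hy 2 (by decide)) (hm.reach u hu)

theorem Represents.link (hm : Represents m S rk) {c s r r' : Node} {n : ℕ}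
    (hc : S.IsRep c) (hs : S.IsRep s) (hcs : c ≠ s) (hrr : r = c ∧ r' = s ∨ r = s ∧ r' = c)
    (hn : rk c < rk s ∧ n = rk s ∨ rk c = rk s ∧ n = rk s + 1) (hsz : m.size ≤ m'.size)
    (hcont : ∀ u < m.size, m'.content u = m.content u)
    (h0 : ∀ u < m.size, m'.ptr u 0 = if u = c then s else m.ptr u 0)
    (h1 : ∀ u < m.size, u ≠ s → m'.ptr u 1 = m.ptr u 1)
    (h2 : ∀ u < m.size, m'.ptr u 2 = m.ptr u 2) (hch : Chain m' n (m'.ptr s 1)) :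
    Represents m' (S.merge r r' s) (Function.update rk s n) := by
  refine ⟨hm.size_pos.trans_le hsz, fun u hu => (hm.lt_size u hu).trans_le hsz, ?_,
    hm.forest.link hc hs hcs hrr hn fun u hu => h0 u (hm.lt_size u hu), ?_, ?_⟩ <;>
    intro u (hu : u ∈ S.elems)
  · rw [hcont u (hm.lt_size u hu)]; exact hm.isLeft u hu
  · intro h
    by_cases hus : u = s
    · subst hus; rwa [Function.update_self]
    · rw [Function.update_of_ne hus, h1 u (hm.lt_size u hu) hus]
      have h' : m.ptr u 0 = u := by
        rw [h0 u (hm.lt_size u hu)] at h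
        split_ifs at h with huc
        · exact absurd h.symm hus
        · exact h
      refine (hm.chain u hu h').congr hsz fun y hy hr => ⟨by rwa [hcont y hy], ?_⟩
      rw [h0 y hy, if_neg]
      rintro rfl
      have := hm.isLeft y hc.1
      rw [← Sum.not_isRight] at this
      simp [hr] at this
  · exact reach_congr hsz h2 (hm.reach u hu)

/-- The root `c` becomes a child of the root `s`, which has greater rank. -/
theorem Represents.setParent (hm : Represents m S rk) {c s r r' : Node}
    (hc : S.IsRep c) (hs : S.IsRep s) (hcs : c ≠ s) (hrr : r = c ∧ r' = s ∨ r = s ∧ r' = c)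
    (hlt : rk c < rk s) (h : m.Ext m') :
    Represents (m'.setPtr c 0 s) (S.merge r r' s) (Function.update rk s (rk s)) := by
  have hp : ∀ u < m.size, ∀ i, (m'.setPtr c 0 s).ptr u i =
      if u = c ∧ i = 0 then s else m.ptr u i := by
    intro u hu i
    by_cases huc : u = c
    · subst huc
      simp [Memory.setPtr, Function.update_apply, (h.2 u hu).2]
    · simp [Memory.setPtr, huc, (h.2 u hu).2]
  refine hm.link hc hs hcs hrr (Or.inl ⟨hlt, rfl⟩) h.1 (fun u hu => (h.2 u hu).1)
    (fun u hu => by simp [hp u hu]) (fun u hu _ => by simp [hp u hu])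
    (fun u hu => by simp [hp u hu]) ?_
  have hsl := hm.lt_size s hs.1
  have hps : m.ptr s 0 = s := by have := hm.forest.par_rep s hs.1; rwa [hs.2] at this
  rw [hp s hsl]
  simp only [hcs.symm, false_and, if_false]
  refine (hm.chain s hs.1 hps).congr h.1 fun u hu hr => ⟨?_, ?_⟩
  · rw [← (h.2 u hu).1] at hr
    exact hr
  · rw [hp u hu, if_neg]
    rintro ⟨rfl, -⟩
    have := hm.isLeft u hc.1
    rw [← Sum.not_isRight] at this
    simp [hr] at this

section Execution

/-! ### Executing the programs -/

variable {D : Type*} [LinearOrder D] {m : Memory D 3 1} {S : SetSystem} {rk : Node → ℕ}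
  {Q : Memory D 3 1 → Node → Prop} {T : ℕ}

theorem init_cells_one (x : Node) :
    (fun i : Fin (3 + 3) => [root, x].getD i root) = ![root, x, root, root, root, root] := by
  ext i; fin_cases i <;> rfl

theorem init_cells_two (x y : Node) :
    (fun i : Fin (3 + 3) => [root, x, y].getD i root) = ![root, x, y, root, root, root] := by
  ext i; fin_cases i <;> rfl

theorem halts_makeSet (hm : Represents m S rk) (v : D) :
    Halts makeSetProgram ⟨0, m.alloc (Sum.inl v), ![root, m.size, root, root, root, root]⟩ 8
      fun m' out => out = m.size ∧
        Represents m' (S.addSingleton m.size) (Function.update rk m.size 0) ∧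
        m'.ptr m.size 0 = m.size ∧ ∀ u ∈ S.elems, m'.ptr u 0 = m.ptr u 0 := by
  refine .copy rfl (.traverse rfl (.store rfl (.store rfl (.create rfl (.store rfl (.copy rfl
    (.halt rfl ?_)))))))
  simp only [update_cell_zero, update_cell_two, update_cell_three, Matrix.cons_val]
  have hpos := hm.size_pos
  have hr : m.size ≠ root := hpos.ne'
  have hr' : m.size + 1 ≠ root := Nat.succ_ne_zero _
  refine ⟨trivial, hm.addSingleton le_rfl ?_ ?_ ?_ ?_ ?_ ?_ ?_ ?_ ?_ ?_, ?_, ?_⟩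
  · simp [Memory.setPtr, Memory.alloc]
  · intro u hu
    have h1 : u ≠ m.size := hu.ne
    have h2 : u ≠ m.size + 1 := (hu.trans (Nat.lt_succ_self _)).ne
    simp [Memory.setPtr, Memory.alloc, h1, h2]
  · simp [Memory.setPtr, Memory.alloc]
  · intro u hu
    have h1 : u ≠ m.size := hu.ne
    have h2 : u ≠ m.size + 1 := (hu.trans (Nat.lt_succ_self _)).ne
    by_cases h3 : u = root
    · subst h3; simp [Memory.setPtr, Memory.alloc, h1, h2]
    · simp [Memory.setPtr, Memory.alloc, h1, h2, h3]
  · simp [Memory.setPtr, Memory.alloc, hr]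
  · intro u hu
    have h1 : u ≠ m.size := hu.ne
    have h2 : u ≠ m.size + 1 := (hu.trans (Nat.lt_succ_self _)).ne
    by_cases h3 : u = root
    · subst h3; simp [Memory.setPtr, Memory.alloc, h1, h2]
    · simp [Memory.setPtr, Memory.alloc, h1, h2, h3]
  · simp [Memory.setPtr, Memory.alloc, hr, Chain]
  · simp [Memory.setPtr, Memory.alloc, hr, hr.symm, hr'.symm]
  · simp [Memory.setPtr, Memory.alloc, hr, hr.symm]
  · intro u hu h3
    have h1 : u ≠ m.size := hu.ne
    have h2 : u ≠ m.size + 1 := (hu.trans (Nat.lt_succ_self _)).ne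
    simp [Memory.setPtr, Memory.alloc, h1, h2, h3]
  · simp [Memory.setPtr, Memory.alloc, hr]
  · intro u hu
    have hlt := hm.lt_size u hu
    have h1 : u ≠ m.size := hlt.ne
    have h2 : u ≠ m.size + 1 := (hlt.trans (Nat.lt_succ_self _)).ne
    by_cases h3 : u = root
    · subst h3; simp [Memory.setPtr, Memory.alloc, h1, h2]
    · simp [Memory.setPtr, Memory.alloc, h1, h2, h3]

/-- Each node on the way up, the root included, takes four instructions. Memory only gains nodes for
the outcomes of tests. -/
theorem halts_findRoot {x z a₀ a₁ a₂ a₄ a₅ : Node} {L : List Node}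
    (hz : z < m.size) (hzl : (m.content z).isLeft) (hpz : m.ptr z 0 = z)
    (hLs : ∀ u ∈ L, u < m.size ∧ (m.content u).isLeft)
    (hL : IsPath (fun u => m.ptr u 0) z x L)
    (H : ∀ m' b₃ b₄, m.Ext m' → Halts findProgram ⟨5, m', ![a₀, a₁, z, b₃, b₄, a₅]⟩ T Q) :
    Halts findProgram ⟨1, m, ![a₀, a₁, a₂, x, a₄, a₅]⟩ (T + 4 * L.length + 4) Q := by
  induction L generalizing x m a₂ a₄ with
  | nil =>
    cases hL
    refine .copy rfl (.traverse rfl (.branchSame rfl rfl ?_ fun m' b₄ hm' hb => ?_))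
    · simp [update_cell_two, hpz]
    · simpa [update_cell_two, update_cell_three, update_cell_four, hpz] using H m' _ b₄ hm'
  | cons y L ih =>
    obtain ⟨rfl, h1, h2, h3⟩ := hL
    simp only at h2 h3
    have hl : (m.content (m.ptr x 0)).isLeft := by
      cases L with
      | nil => cases h3; exact hzl
      | cons y L => obtain ⟨rfl, -⟩ := h3; exact (hLs _ (by simp)).2
    have hT : T + 4 * (x :: L).length + 4 = T + 4 * L.length + 4 + 2 + 1 + 1 := by
      simp only [List.length_cons]; ring
    rw [hT]
    refine .copy rfl (.traverse rfl (.branchSame rfl rfl ?_ fun m' b₄ hm' hb => ?_))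
    · simp [update_cell_two, hl, (hLs x (by simp)).2]
    · simp only [update_cell_two, update_cell_three, update_cell_four, Matrix.cons_val,
        if_neg h2.symm]
      refine ih (hz.trans_le hm'.1) (by rwa [(hm'.2 z hz).1]) (by rwa [(hm'.2 z hz).2])
        (fun u hu => ?_) (h3.congr fun u hu => ?_) fun m'' b₃ b₄ h => H m'' b₃ b₄ (hm'.trans h)
      · have := hLs u (by simp [hu])
        exact ⟨this.1.trans_le hm'.1, by rw [(hm'.2 u this.1).1]; exact this.2⟩
      · simp only [(hm'.2 u (hLs u (by simp [hu])).1).2]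

/-- A round takes seven instructions and alters only the current node. That node does not recur on
the path, so the rest is still a path in the new memory. -/
theorem halts_compress {x z a₀ a₃ a₄ a₅ : Node} {L : List Node}
    (hzl : (m.content z).isLeft)
    (hLs : ∀ u ∈ L, u < m.size ∧ (m.content u).isLeft) (hnd : L.Nodup)
    (hL : IsPath (fun u => m.ptr u 0) z x L) (hz : z < m.size)
    (H : ∀ m' : Memory D 3 1, m.size ≤ m'.size → (∀ u < m.size, m'.content u = m.content u) →
      (∀ u < m.size, m'.ptr u = if u ∈ L then Function.update (m.ptr u) 0 z else m.ptr u) →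
      Q m' z) :
    Halts findProgram ⟨5, m, ![a₀, x, z, a₃, a₄, a₅]⟩ (7 * L.length + 4) Q := by
  induction L generalizing x m a₃ a₄ with
  | nil =>
    cases hL
    refine .branchSame rfl rfl rfl fun m' b₄ hm' hb => ?_
    simp only [update_cell_four, Matrix.cons_val, if_true]
    refine .copy rfl (.halt rfl ?_)
    simp only [update_cell_zero, Matrix.cons_val]
    exact H m' hm'.1 (fun u hu => (hm'.2 u hu).1) fun u hu => by simp [(hm'.2 u hu).2]
  | cons y L ih =>
    obtain ⟨rfl, h1, h2, h3⟩ := hL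
    simp only at h2 h3
    obtain ⟨hxL, hnd'⟩ := List.nodup_cons.mp hnd
    obtain ⟨hxs, hxl⟩ := hLs x (by simp)
    have hT : 7 * (x :: L).length + 4 = 7 * L.length + 4 + 1 + 1 + 1 + 1 + 1 + 2 := by
      simp only [List.length_cons]; ring
    rw [hT]
    refine .branchSame rfl rfl (by simp [hxl, hzl]) fun m' b₄ hm' hb => ?_
    simp only [update_cell_four, Matrix.cons_val, h1, if_false]
    refine .copy rfl (.traverse rfl (.store rfl (.copy rfl (.jump rfl ?_ ?_))))
    · simpa [update_cell_one, update_cell_three, Memory.setPtr] using hb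
    simp only [update_cell_one, update_cell_three, Matrix.cons_val, (hm'.2 x hxs).2]
    have hsz : (m'.setPtr x 0 z).size = m'.size := rfl
    have hct : (m'.setPtr x 0 z).content = m'.content := rfl
    refine ih ?_ (fun u hu => ?_) hnd' (h3.congr fun u hu => ?_) (hz.trans_le hm'.1)
      fun m'' hs hc hp => H m'' (hm'.1.trans hs) (fun u hu => ?_) fun u hu => ?_
    · rwa [hct, (hm'.2 z hz).1]
    · have := hLs u (by simp [hu])
      exact ⟨this.1.trans_le hm'.1, by rw [hct, (hm'.2 u this.1).1]; exact this.2⟩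
    · have hux : u ≠ x := fun h => hxL (h ▸ hu)
      simp [Memory.setPtr, hux, (hm'.2 u (hLs u (by simp [hu])).1).2]
    · rw [hc u (hu.trans_le hm'.1), hct, (hm'.2 u hu).1]
    · rw [hp u (hu.trans_le hm'.1)]
      by_cases hux : u = x
      · subst hux
        simp [hxL, Memory.setPtr, (hm'.2 u hu).2]
      · simp [hux, Memory.setPtr, (hm'.2 u hu).2]

theorem halts_find (hm : Represents m S rk) {x : Node} (hx : x ∈ S.elems) {L : List Node}
    (hL : IsPath (fun u => m.ptr u 0) (S.rep x) x L) :
    Halts findProgram ⟨0, m, ![root, x, root, root, root, root]⟩ (11 * L.length + 9)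
      fun m' out => out = S.rep x ∧ Represents m' S rk ∧
        ∀ u ∈ S.elems, m'.ptr u 0 = if u ∈ L then S.rep x else m.ptr u 0 := by
  have hzE := hm.forest.rep_mem x hx
  have hz := hm.lt_size _ hzE
  have hzl := hm.isLeft _ hzE
  obtain ⟨-, -, hLE⟩ := hm.forest.path_props hx hL
  have hLs : ∀ u ∈ L, u < m.size ∧ (m.content u).isLeft := fun u hu =>
    ⟨hm.lt_size u (hLE u hu).1, hm.isLeft u (hLE u hu).1⟩
  have hT : 11 * L.length + 9 = 7 * L.length + 4 + 4 * L.length + 4 + 1 := by ring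
  rw [hT]
  refine .copy rfl ?_
  simp only [update_cell_three, Matrix.cons_val]
  refine halts_findRoot hz hzl (hm.forest.par_rep x hx) hLs hL fun m₁ b₃ b₄ h₁ => ?_
  refine halts_compress (by rwa [(h₁.2 _ hz).1]) (fun u hu => ?_) (hm.forest.path_nodup hx hL)
    (hL.congr fun u hu => by simp only [(h₁.2 u (hLs u hu).1).2]) (hz.trans_le h₁.1)
    fun m' hs hc hp => ?_
  · exact ⟨(hLs u hu).1.trans_le h₁.1, by rw [(h₁.2 u (hLs u hu).1).1]; exact (hLs u hu).2⟩
  have hp' : ∀ u < m.size, m'.ptr u =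
      if u ∈ L then Function.update (m.ptr u) 0 (S.rep x) else m.ptr u := fun u hu => by
    rw [hp u (hu.trans_le h₁.1), (h₁.2 u hu).2]
  refine ⟨rfl, hm.compress hx hL (h₁.1.trans hs)
    (fun u hu => (hc u (hu.trans_le h₁.1)).trans (h₁.2 u hu).1) hp', fun u hu => ?_⟩
  rw [hp' u (hm.lt_size u hu)]
  split_ifs <;> simp

/-- Both chains are followed in lockstep, eleven instructions per round, until the shorter one ends.
-/
theorem halts_compareRanks {i j : ℕ} {a₀ r r' a₃ a₄ a₅ : Node}
    (hi : Chain m i a₃) (hj : Chain m j a₄)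
    (Hlt : i < j → ∀ m' b₀ b₃ b₄ b₅, m.Ext m' →
      Halts linkProgram ⟨24, m', ![b₀, r, r', b₃, b₄, b₅]⟩ T Q)
    (Heq : i = j → ∀ m' b₀ b₃ b₄ b₅, m.Ext m' →
      Halts linkProgram ⟨19, m', ![b₀, r, r', b₃, b₄, b₅]⟩ T Q)
    (Hgt : j < i → ∀ m' b₀ b₃ b₄ b₅, m.Ext m' →
      Halts linkProgram ⟨27, m', ![b₀, r, r', b₃, b₄, b₅]⟩ T Q) :
    Halts linkProgram ⟨4, m, ![a₀, r, r', a₃, a₄, a₅]⟩ (T + 11 * min i j + 9) Q := by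
  induction i generalizing j m a₀ a₃ a₄ a₅ with
  | zero =>
    refine Halts.mono (T := T + 2 + 1 + 1 + 2 + 1 + 1) ?_ (by omega)
    refine .copy rfl (.traverse rfl (.branchSame rfl rfl ?_ fun m₁ b₀ h₁ hb => ?_))
    · simp [update_cell_five, hi.2.2]
    simp only [update_cell_five, update_cell_zero, Matrix.cons_val, hi.2.2, if_true]
    refine .copy rfl (.traverse rfl (.branchSame rfl rfl ?_ fun m₂ b₀' h₂ hb' => ?_))
    · simpa [update_cell_five] using (hj.ext h₁).isLeft_eq
    simp only [update_cell_five, update_cell_zero, Matrix.cons_val, (h₁.2 _ hj.lt_size).2]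
    cases j with
    | zero =>
      rw [if_pos hj.2.2.symm]
      exact Heq rfl _ _ _ _ _ (h₁.trans h₂)
    | succ j =>
      rw [if_neg hj.2.2.1.symm]
      exact Hlt (Nat.succ_pos j) _ _ _ _ _ (h₁.trans h₂)
  | succ i ih =>
    -- One bound for two cases. If `j = 0`, the truncated subtraction leaves `T` after nine
    -- instructions; otherwise two more instructions close the round and the induction hypothesis
    -- takes over.
    have key : Halts linkProgram ⟨4, m, ![a₀, r, r', a₃, a₄, a₅]⟩
        (T + 11 * min i (j - 1) + 9 - (if j = 0 then 9 + 11 * min i (j - 1) else 0)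
          + (if j = 0 then 0 else 2) + 2 + 1 + 1 + 1 + 2 + 1 + 1) Q := by
      refine .copy rfl (.traverse rfl (.branchSame rfl rfl ?_ fun m₁ b₀ h₁ hb => ?_))
      · simp [update_cell_five, hi.isLeft_eq]
      simp only [update_cell_five, update_cell_zero, Matrix.cons_val, if_neg hi.2.2.1.symm]
      refine .copy rfl (.copy rfl (.traverse rfl (.branchSame rfl rfl ?_
        fun m₂ b₀' h₂ hb' => ?_)))
      · simpa [update_cell_five, update_cell_three] using (hj.ext h₁).isLeft_eq
      simp only [update_cell_five, update_cell_three, update_cell_zero, Matrix.cons_val,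
        (h₁.2 _ hj.lt_size).2]
      cases j with
      | zero =>
        rw [if_pos hj.2.2.symm]
        exact (Hgt (Nat.succ_pos i) _ _ _ _ _ (h₁.trans h₂)).mono (by simp)
      | succ j =>
        rw [if_neg hj.2.2.1.symm]
        simp only [Nat.succ_ne_zero, if_false, Nat.sub_zero, Nat.add_sub_cancel]
        refine .copy rfl (.jump rfl ?_ ?_)
        · simpa [update_cell_four] using hb'
        simp only [update_cell_four, Matrix.cons_val]
        have h12 := h₁.trans h₂
        exact ih (hi.2.2.2.ext h12) (hj.2.2.2.ext h12)
          (fun h m' _ _ _ _ h' => Hlt (by omega) m' _ _ _ _ (h12.trans h'))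
          (fun h m' _ _ _ _ h' => Heq (by omega) m' _ _ _ _ (h12.trans h'))
          (fun h m' _ _ _ _ h' => Hgt (by omega) m' _ _ _ _ (h12.trans h'))
    refine key.mono ?_
    split_ifs <;> omega

theorem halts_link (hm : Represents m S rk) {r r' : Node} (hr : S.IsRep r) (hr' : S.IsRep r')
    (hne : r ≠ r') :
    Halts linkProgram ⟨0, m, ![root, r, r', root, root, root]⟩
      (11 * min (rk r) (rk r') + 21) fun m' out => ∃ c s n,
        (r = c ∧ r' = s ∨ r = s ∧ r' = c) ∧
        (rk c < rk s ∧ n = rk s ∨ rk c = rk s ∧ n = rk s + 1) ∧ out = s ∧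
        Represents m' (S.merge r r' s) (Function.update rk s n) ∧
        ∀ u ∈ S.elems, m'.ptr u 0 = if u = c then s else m.ptr u 0 := by
  have hp : m.ptr r 0 = r := by have := hm.forest.par_rep r hr.1; rwa [hr.2] at this
  have hp' : m.ptr r' 0 = r' := by have := hm.forest.par_rep r' hr'.1; rwa [hr'.2] at this
  have hs := hm.lt_size r hr.1
  have hs' := hm.lt_size r' hr'.1
  have hT : 11 * min (rk r) (rk r') + 21 = 8 + 11 * min (rk r) (rk r') + 9 + 1 + 1 + 1 + 1 := by
    ring
  rw [hT]
  refine .copy rfl (.traverse rfl (.copy rfl (.traverse rfl ?_)))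
  simp only [update_cell_three, update_cell_four, Matrix.cons_val]
  refine halts_compareRanks (hm.chain r hr.1 hp) (hm.chain r' hr'.1 hp') ?_ ?_ ?_
  · intro hlt m₁ b₀ b₃ b₄ b₅ h₁
    refine Halts.mono (T := 3) (.store rfl (.copy rfl (.halt rfl ?_))) (by omega)
    simp only [update_cell_zero, Matrix.cons_val]
    refine ⟨r, r', rk r', Or.inl ⟨rfl, rfl⟩, Or.inl ⟨hlt, rfl⟩, rfl,
      hm.setParent hr hr' hne (Or.inl ⟨rfl, rfl⟩) hlt h₁, fun u hu => ?_⟩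
    by_cases hur : u = r
    · simp [hur, Memory.setPtr]
    · simp [hur, Memory.setPtr, (h₁.2 u (hm.lt_size u hu)).2]
  · intro heq m₁ b₀ b₃ b₄ b₅ h₁
    refine Halts.mono (T := 8) (.create rfl (.copy rfl (.traverse rfl (.store rfl (.store rfl
      (.store rfl (.copy rfl (.halt rfl ?_)))))))) (by omega)
    simp only [update_cell_zero, update_cell_three, update_cell_five, Matrix.cons_val]
    have hr1 : r ≠ m₁.size := (hs.trans_le h₁.1).ne
    have hr1' : r' ≠ m₁.size := (hs'.trans_le h₁.1).ne
    have hrk : (m₁.alloc (Sum.inr fun _ => false)).ptr r' 1 = m.ptr r' 1 := by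
      simp [Memory.alloc, hr1', (h₁.2 r' hs').2]
    rw [hrk]
    -- The final memory: a new node is put in front of the rank chain of `r'`, and `r` becomes a
    -- child of `r'`.
    generalize hm' : ((((m₁.alloc (Sum.inr fun _ => false)).setPtr m₁.size 0
      (m.ptr r' 1)).setPtr r' 1 m₁.size).setPtr r 0 r') = m'
    have hsize : m'.size = m₁.size + 1 := by subst hm'; rfl
    have hcont : ∀ u < m.size, m'.content u = m.content u := by
      intro u hu
      have hu1 : u ≠ m₁.size := (hu.trans_le h₁.1).ne
      subst hm'
      simp [Memory.setPtr, Memory.alloc, hu1, (h₁.2 u hu).1]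
    have hptr : ∀ u < m.size, ∀ i, m'.ptr u i = if u = r ∧ i = 0 then r' else
        if u = r' ∧ i = 1 then m₁.size else m.ptr u i := by
      intro u hu i
      have hu1 : u ≠ m₁.size := (hu.trans_le h₁.1).ne
      subst hm'
      by_cases h2 : u = r
      · subst h2
        simp [Memory.setPtr, Memory.alloc, Function.update_apply, hne, hu1, (h₁.2 u hu).2]
      · by_cases h3 : u = r'
        · subst h3
          simp [Memory.setPtr, Memory.alloc, Function.update_apply, h2, hu1, (h₁.2 u hu).2]
        · simp [Memory.setPtr, Memory.alloc, h2, h3, hu1, (h₁.2 u hu).2]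
    have hnew : (m'.content m₁.size).isRight ∧ m'.ptr m₁.size 0 = m.ptr r' 1 := by
      subst hm'
      simp [Memory.setPtr, Memory.alloc, hr1.symm, hr1'.symm]
    refine ⟨r, r', rk r' + 1, Or.inl ⟨rfl, rfl⟩, Or.inr ⟨heq, rfl⟩, rfl, hm.link hr hr' hne
      (Or.inl ⟨rfl, rfl⟩) (Or.inr ⟨heq, rfl⟩) (by rw [hsize]; exact h₁.1.trans (Nat.le_succ _))
      hcont (fun u hu => by simp [hptr u hu]) (fun u hu h => by simp [hptr u hu, h])
      (fun u hu => by simp [hptr u hu]) ?_, fun u hu => by simp [hptr u (hm.lt_size u hu)]⟩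
    have hch := hm.chain r' hr'.1 hp'
    have : m'.ptr r' 1 = m₁.size := by simp [hptr r' hs']
    rw [this]
    refine ⟨by rw [hsize]; exact Nat.lt_succ_self _, hnew.1, ?_, ?_⟩ <;> rw [hnew.2]
    · exact (hch.lt_size.trans_le h₁.1).ne
    · refine hch.congr (by rw [hsize]; exact h₁.1.trans (Nat.le_succ _)) fun u hu hur =>
        ⟨by rwa [hcont u hu], ?_⟩
      have hu2 : u ≠ r := by
        rintro rfl
        have := hm.isLeft u hr.1
        rw [← Sum.not_isRight] at this
        simp [hur] at this
      simp [hptr u hu, hu2]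
  · intro hlt m₁ b₀ b₃ b₄ b₅ h₁
    refine Halts.mono (T := 3) (.store rfl (.copy rfl (.halt rfl ?_))) (by omega)
    simp only [update_cell_zero, Matrix.cons_val]
    refine ⟨r', r, rk r, Or.inr ⟨rfl, rfl⟩, Or.inl ⟨hlt, rfl⟩, rfl,
      hm.setParent hr' hr hne.symm (Or.inr ⟨rfl, rfl⟩) hlt h₁, fun u hu => ?_⟩
    by_cases hur : u = r'
    · simp [hur, Memory.setPtr]
    · simp [hur, Memory.setPtr, (h₁.2 u (hm.lt_size u hu)).2]

/-! ### The amortized analysis -/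

/-- Eleven times the potential of a represented forest. -/
def credit (m : Memory D 3 1) (S : SetSystem) (rk : Node → ℕ) : ℕ :=
  11 * potential S.elems (fun x => m.ptr x 0) rk

/-- The factor 11 in `credit` is the cost of one path node in `find` (4 + 7) and of one round in
`link`. The constant 162 = 8 + 11 · 14 comes from `makeSet`; `link` needs 21, and `find` needs 22α +
31 ≤ 53α. -/
theorem exists_performs (hm : Represents m S rk) (op : Op D) (hop : op.Legal S) :
    ∃ t m' S' rk', linkByRank.Performs m S op t m' S' ∧ Represents m' S' rk' ∧
      t + credit m' S' rk' ≤ credit m S rk + 162 * op.cost S := by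
  cases op with
  | makeSet v =>
    have H := halts_makeSet hm v
    rw [← init_cells_one] at H
    obtain ⟨t, ht, m', _, hcall, rfl, hrep, hx, hp⟩ := H.exists_call
    refine ⟨t, m', _, _, ⟨_, hcall, rfl, rfl⟩, hrep, ?_⟩
    rw [credit, credit, hm.forest.potential_addSingleton
      (fun h => lt_irrefl _ (hm.lt_size _ h)) hx hp]
    simp only [Op.cost]
    omega
  | link r r' =>
    obtain ⟨hr, hr', hne⟩ := hop
    have H := halts_link hm hr hr' hne
    rw [← init_cells_two] at H
    obtain ⟨t, ht, m', s, hcall, c, _, n, hrr, hn, hout, hrep, hp⟩ := H.exists_call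
    subst hout
    have hcs : S.IsRep c ∧ S.IsRep s ∧ c ≠ s := by
      rcases hrr with ⟨rfl, rfl⟩ | ⟨rfl, rfl⟩
      exacts [⟨hr, hr', hne⟩, ⟨hr', hr, hne.symm⟩]
    refine ⟨t, m', S.merge r r' s, _, ⟨s, hcall, ?_, rfl⟩, hrep, ?_⟩
    · have h : ∀ x, S.IsRep x → x ∈ S.setOf x := fun x hx =>
        Finset.mem_filter.mpr ⟨hx.1, rfl⟩
      rw [Finset.mem_union]
      rcases hrr with ⟨rfl, rfl⟩ | ⟨rfl, rfl⟩
      exacts [Or.inr (h _ hr'), Or.inl (h _ hr)]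
    · have hpot := hm.forest.potential_link hcs.1 hcs.2.1 hcs.2.2 hn hp
      have hmin : min (rk r) (rk r') ≤ rk c := by
        rcases hrr with ⟨rfl, rfl⟩ | ⟨rfl, rfl⟩
        exacts [min_le_left _ _, min_le_right _ _]
      simp only [credit, Op.cost, SetSystem.merge]
      omega
  | find x =>
    obtain ⟨L, hL⟩ := hm.forest.exists_isPath hop
    have H := halts_find hm hop hL
    rw [← init_cells_one] at H
    obtain ⟨t, ht, m', _, hcall, rfl, hrep, hp⟩ := H.exists_call
    refine ⟨t, m', S, rk, ⟨_, hcall, rfl, rfl⟩, hrep, ?_⟩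
    have hpot := hm.forest.potential_compress hop hL hp
    have h1 := (invAck_spec (S.setOf x).card).1
    simp only [credit, Op.cost]
    omega

/-- The specification of `link` leaves the representative open, but the output of the program fixes
it, and with it the new set system. -/
theorem Performs.deterministic {op : Op D} {t t' : ℕ} {m' m'' : Memory D 3 1} {S' S'' : SetSystem}
    (h : linkByRank.Performs m S op t m' S') (h' : linkByRank.Performs m S op t' m'' S'') :
    t = t' ∧ m' = m'' ∧ S' = S'' := by
  obtain ⟨x, hc, hs⟩ := h
  obtain ⟨y, hc', hs'⟩ := h'
  have h : t = t' ∧ m' = m'' ∧ x = y := by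
    cases op <;> exact Call.deterministic hc hc'
  obtain ⟨rfl, rfl, rfl⟩ := h
  refine ⟨rfl, rfl, ?_⟩
  cases op <;> exact hs.2.trans hs'.2.symm

/-- The costs telescope, since the initial credit is zero; as credit is never negative, it can be
dropped at the end. -/
theorem History.represents {m : Memory D linkByRank.d linkByRank.b} {ops : List (Op D)} {t a : ℕ}
    (h : linkByRank.History ops m S t a) :
    ∃ rk, Represents m S rk ∧ t + credit m S rk ≤ 162 * a := by
  induction h with
  | nil => exact ⟨_, represents_init, by simp [credit, potential, SetSystem.empty]⟩
  | snoc _ legal perf ih =>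
    obtain ⟨rk, hm, hle⟩ := ih
    obtain ⟨t', m', S', rk', hperf, hm', hle'⟩ := exists_performs hm _ legal
    obtain ⟨rfl, rfl, rfl⟩ := Performs.deterministic perf hperf
    exact ⟨rk', hm', by rw [mul_add]; omega⟩

end Execution

end UnionFind

/-! ### The union-find bound -/

theorem lemma5 :
    ∃ (U : UnionFind.Implementation) (C : ℕ), ∀ (D : Type*) [LinearOrder D],
      U.Correct D ∧
      ∀ (ops : List (UnionFind.Op D)) (m : PointerMachine.Memory D U.d U.b)
        (S : UnionFind.SetSystem) (t a : ℕ), U.History ops m S t a → t ≤ C * a := by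
  refine ⟨UnionFind.linkByRank, 162, fun D _ => ⟨fun ops m S t a h => ?_, fun ops m S t a h => ?_⟩⟩
  · obtain ⟨rk, hm, -⟩ := UnionFind.History.represents h
    refine ⟨fun op hop => ?_, fun x hx => hm.reachable hx⟩
    obtain ⟨t', m', S', -, hperf, -⟩ := UnionFind.exists_performs hm op hop
    exact ⟨t', m', S', hperf⟩
  · obtain ⟨rk, -, hle⟩ := UnionFind.History.represents h
    omega
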